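/- Let $F$ be a probability distribution on $\mathbb R$ with tail $\overline F=1-F$, let $(X_i)_{i\in\mathbb Z}$ be independent random variables with distribution $F$, let $(c_i)_{i\in\mathbb Z}$ be real numbers, and let $G$ be the distribution of $\sum_{i\in\mathbb Z}c_iX_i$. For $c\in\mathbb R$ let $M_cF$ be the distribution of $cX_0$. Assume that $F$ ultimately has a hazard rate $h=F'/\overline F$ (so that $\overline F(t)=\overline F(t_0)\exp(-\int_{t_0}^t h(u)\,du)>0$ for all $t\ge t_0$, for some $t_0$) such that (a) $h$ is regularly varying, $\lim_{t\to\infty}th(t)=\infty$ and $\lim_{t\to\infty}h(t)=0$; (b) $h(t)=o(t^{-1}\log t)$ as $t\to\infty$; (c) $\limsup_{t\to\infty} t\,h(t)^2/h(1/h(t))<\infty$. Assume further that $\sum_{i\in\mathbb Z}|c_i|^\delta<\infty$ for some $0<\delta<1$, and that either $F$ vanishes on a neighborhood of $-\infty$, or $F$ is strongly tail balanced, that is, $\overline F/\overline{M_{-1}F}$ has a positive finite limit at infinity and $M_{-1}F$ ultimately has a hazard rate $h_-$ which also satisfies (a), (b) and (c). For real $a,b$ write $a\prec b$ if $\overline{M_aF}=o(\overline{M_bF})$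 at infinity, $a\equiv b$ if for some $\epsilon>0$ ultimately $\epsilon\overline{M_aF}\le\overline{M_bF}\le\epsilon^{-1}\overline{M_aF}$, and $b\succeq a$ if $a\prec b$ or $a\equiv b$. Let $(c_{(n)})_{n\ge1}$ be the weights $(c_i)$ arranged in nonincreasing $\prec$ order and without multiplicity (one representative of each class for $\equiv$, strictly decreasing until, possibly, the class of the minimal element $0$ is reached, from where on the sequence is constantly $0$). Then the series $\sum_i c_iX_i$ converges absolutely almost surely, and for every positive integer $m$ with $c_{(m)}\neq0$ there are only finitely many $i$ with $c_i\succeq c_{(m)}$, and $$\overline G=\sum_{i:\,c_i\succeq c_{(m)}}\overline{M_{c_i}F}+o\bigl(\overline{M_{c_{(m)}}F}\bigr)\qquad\text{at infinity.}$$ -/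

import Mathlib

open MeasureTheory ProbabilityTheory Filter Asymptotics Topology

namespace LightTail

/-- The tail function `t ↦ F(t, ∞)` of the distribution `F`. -/
noncomputable def tail (F : Measure ℝ) (t : ℝ) : ℝ := F.real (Set.Ioi t)

/-- `mulDist c F` is the distribution of `c X` when `X` has distribution `F`. -/
noncomputable def mulDist (c : ℝ) (F : Measure ℝ) : Measure ℝ := F.map (fun x => c * x)

/-- `h` is regularly varying at infinity with index `ρ`: it is ultimately (Lebesgue) measurable and
positive, and `h (x t) / h t → x ^ ρ` as `t → ∞` for every `x > 0`. -/
structure RegVaryingWith (h : ℝ → ℝ) (ρ : ℝ) : Prop where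
  measurable : ∃ t₀ : ℝ, AEMeasurable h (volume.restrict (Set.Ici t₀))
  pos : ∀ᶠ t in atTop, 0 < h t
  tendsto : ∀ x : ℝ, 0 < x → Tendsto (fun t => h (x * t) / h t) atTop (𝓝 (x ^ ρ))

/-- `h` is regularly varying at infinity (with some real index). -/
def RegVarying (h : ℝ → ℝ) : Prop := ∃ ρ : ℝ, RegVaryingWith h ρ

/-- `h` is, ultimately, a hazard rate of `F`: ultimately `F` has a density `F'` and
`h = F' / tail F`, in the form `tail F t = tail F t₀ * exp (- ∫_{t₀}^t h)` for `t ≥ t₀`. -/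
def IsHazardRate (F : Measure ℝ) (h : ℝ → ℝ) : Prop :=
  ∃ t₀ : ℝ, 0 < tail F t₀ ∧ ∀ t, t₀ ≤ t →
    IntervalIntegrable h volume t₀ t ∧
      tail F t = tail F t₀ * Real.exp (- ∫ u in t₀..t, h u)

/-- If the tail is ultimately positive and differentiable, with derivative `- h * tail F`, i.e. if
`h = F' / tail F` pointwise, then `h` is a hazard rate of `F`. -/
theorem isHazardRate_of_hasDerivAt (F : Measure ℝ) [IsProbabilityMeasure F] (h : ℝ → ℝ) (t₀ : ℝ)
    (hpos : ∀ t, t₀ ≤ t → 0 < tail F t)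
    (hd : ∀ t, t₀ ≤ t → HasDerivAt (tail F) (-(h t * tail F t)) t) : IsHazardRate F h := by
  have hanti : Antitone (tail F) := fun a b hab =>
    measureReal_mono (Set.Ioi_subset_Ioi hab)
  have hnn : ∀ t, t₀ ≤ t → 0 ≤ h t := by
    intro t ht
    have h1 : deriv (tail F) t ≤ 0 := hanti.deriv_nonpos
    rw [(hd t ht).deriv] at h1
    have := hpos t ht
    by_contra hc
    push Not at hc
    nlinarith [mul_pos (neg_pos.2 hc) this]
  have hg : ∀ t, t₀ ≤ t → HasDerivAt (fun s => -Real.log (tail F s)) (h t) t := by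
    intro t ht
    have h1 := ((hd t ht).log (hpos t ht).ne').neg
    have h2 : -(-(h t * tail F t) / tail F t) = h t := by
      have := (hpos t ht).ne'
      field_simp
    rwa [h2] at h1
  refine ⟨t₀, hpos t₀ le_rfl, fun t ht => ?_⟩
  have hint : IntervalIntegrable h volume t₀ t := by
    apply intervalIntegral.intervalIntegrable_deriv_of_nonneg (g := fun s => -Real.log (tail F s))
    · intro x hx
      rw [Set.uIcc_of_le ht] at hx
      exact (hg x hx.1).continuousAt.continuousWithinAt
    · intro x hx
      rw [min_eq_left ht] at hx
      exact hg x hx.1.le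
    · intro x hx
      rw [min_eq_left ht] at hx
      exact hnn x hx.1.le
  refine ⟨hint, ?_⟩
  rw [intervalIntegral.integral_eq_sub_of_hasDerivAt (f := fun s => -Real.log (tail F s)) ?_ hint]
  · have : -(-Real.log (tail F t) - -Real.log (tail F t₀))
        = Real.log (tail F t) - Real.log (tail F t₀) := by ring
    rw [this, Real.exp_sub, Real.exp_log (hpos t ht), Real.exp_log (hpos t₀ le_rfl)]
    field_simp [(hpos t₀ le_rfl).ne']
  · intro x hx
    rw [Set.uIcc_of_le ht] at hx
    exact hg x hx.1

/-- The assumptions made on a hazard rate `h`: it is regularly varying, `t h(t) → ∞`, `h(t) → 0`,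
`h(t) = o(t⁻¹ log t)`, and `limsup t h(t)² / h(1 / h(t)) < ∞`. -/
structure HazardConditions (h : ℝ → ℝ) : Prop where
  regVarying : RegVarying h
  tendsto_mul : Tendsto (fun t => t * h t) atTop atTop
  tendsto_zero : Tendsto h atTop (𝓝 0)
  isLittleO : h =o[atTop] fun t => t⁻¹ * Real.log t
  limsup_lt_top : IsBoundedUnder (· ≤ ·) atTop fun t => t * h t ^ 2 / h (1 / h t)

/-- `F` is tail balanced: `tail F / tail (M_{-1} F)` has a positive finite limit at infinity. -/
def TailBalanced (F : Measure ℝ) : Prop :=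
  ∃ L : ℝ, 0 < L ∧ Tendsto (fun t => tail F t / tail (mulDist (-1) F) t) atTop (𝓝 L)

/-- `F` is strongly tail balanced (relative to `HazardConditions`): it is tail balanced and the
distribution `M_{-1} F` has a hazard rate with the properties required of the hazard rate of `F`. -/
def StronglyTailBalanced (F : Measure ℝ) : Prop :=
  TailBalanced F ∧ ∃ hm : ℝ → ℝ, IsHazardRate (mulDist (-1) F) hm ∧ HazardConditions hm

/-- The standard conditions: `∑ |c i| ^ δ < ∞` for some `0 < δ < 1`, and `F` either vanishes on a
neighbourhood of `-∞` or is strongly tail balanced. -/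
structure StandardConditions (F : Measure ℝ) (c : ℤ → ℝ) : Prop where
  summable : ∃ δ : ℝ, 0 < δ ∧ δ < 1 ∧ Summable fun i => |c i| ^ δ
  lower_tail : (∃ A : ℝ, F (Set.Iic A) = 0) ∨ StronglyTailBalanced F

/-- `a ≺ b`: the tail of `M_a F` is little-o of the tail of `M_b F`. -/
def Prec (F : Measure ℝ) (a b : ℝ) : Prop :=
  tail (mulDist a F) =o[atTop] tail (mulDist b F)

/-- `a ≡ b`: the tails of `M_a F` and `M_b F` are ultimately of the same order. -/
def TailEquiv (F : Measure ℝ) (a b : ℝ) : Prop :=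
  ∃ ε : ℝ, 0 < ε ∧ ∀ᶠ t in atTop,
    ε * tail (mulDist a F) t ≤ tail (mulDist b F) t ∧
      tail (mulDist b F) t ≤ ε⁻¹ * tail (mulDist a F) t

/-- `a ⪯ b`. -/
def Preceq (F : Measure ℝ) (a b : ℝ) : Prop := Prec F a b ∨ TailEquiv F a b

/-- `d 1, d 2, …` (`d 0` is irrelevant) is the sequence of weights `c` arranged in nonincreasing
`≺` order and without multiplicity: its nonzero terms are weights not equivalent to the minimal
element `0`, it is strictly decreasing until it possibly reaches `0`, where it then stays, and every
weight not equivalent to `0` is equivalent to one of its terms. Equivalent weights are represented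
by an arbitrary one of them. -/
structure IsDecreasingRearrangement (F : Measure ℝ) (c : ℤ → ℝ) (d : ℕ → ℝ) : Prop where
  mem_range : ∀ n, 1 ≤ n → d n ≠ 0 → d n ∈ Set.range c
  not_equiv_zero : ∀ n, 1 ≤ n → d n ≠ 0 → ¬ TailEquiv F (d n) 0
  strict_decr : ∀ n, 1 ≤ n → d n ≠ 0 → Prec F (d (n + 1)) (d n)
  stays_zero : ∀ n, 1 ≤ n → d n = 0 → d (n + 1) = 0
  exhausts : ∀ i, ¬ TailEquiv F (c i) 0 → ∃ n, 1 ≤ n ∧ TailEquiv F (c i) (d n)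

end LightTail

/-!
The tail of the series is governed by a single large term. Write `f = tail F` and `κ = |d m|`.

*The tail.* The hypotheses `t h(t) → ∞` and `h(t) = o(t⁻¹ log t)` put `f` between two regimes
(`ModerateTail`). It decays faster than every power, so that a smaller weight has a negligible tail:
`f (b t) = o(f (a t))` for `a < b`. Yet the ratio `f (a t) / f (b t)` is smaller than every positive
power of `t`; hence a bound of the form `t ^ (-ε) * f (a t)`, whatever `a > 0` is, is
negligible against `f (t / κ)`. Moreover, `f x - f y ≤ f x (y - x) x ^ (-3/4)`: a displacement of
the argument by an amount of finite mean changes the tail by a negligible quantity only.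

*The small weights.* If all weights are at most `κ' < κ`, then `P(∑ |c i X i| > t) = o(f (t / κ))`
(`isLittleO_measureReal_tsum_enorm`). For nonnegative independent terms `Z n` with sum `T`, stopping
the partial sums when they first exceed `a` gives the Hoffmann-Jørgensen type inequality
`P(T > a + y + b) ≤ ∑ P(Z n > y) + P(T > a) P(T > b)`. With `y` slightly smaller than `t` and
`a = b = θ t`, the first term is negligible, and Markov's inequality for one of the two factors
bounds the second by `C t⁻¹ P(T > θ t)`. Since `t⁻¹ f (θ t / κ) = o(f (t / κ))`, this recursion
contracts (`isLittleO_of_contraction`).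

*The large weights.* Finitely many `i` have `|c i| ≥ κ`. Let `T i` be the sum of the `|c j X j|`
with `j ≠ i`. Outside events of probability `o(f (t / κ))`, the series exceeds `t` exactly when
`c i X i > t` for one such `i`. The exceptional events are of three kinds: the sum of the small terms
is of order `t`, which was just bounded; both `|c i X i|` and `T i` are of order `t`, which has
probability at most `C t⁻¹ f (a t)` by independence; or `T i` is at most a small multiple of `t` and
`c i X i` lies within `T i` of `t`, which has probability at most `C t ^ (-3/4) f (a t)`
by integrating the displacement bound against the law of `T i` (`isLittleO_tail_tsum`).

Finally, the tail of `M_a F` either vanishes ultimately or is of the exact order of `f (t / |a|)`,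
so that the order of the tails is the order of the absolute values of the weights (`preceq_iff`).
-/

open scoped ENNReal

namespace LightTail

/-! ### The tail of a distribution with a hazard rate -/

theorem tail_antitone (F : Measure ℝ) [IsFiniteMeasure F] : Antitone (tail F) :=
  fun _ _ hab => measureReal_mono (Set.Ioi_subset_Ioi hab)

/-- The exponential formula for the tail, between any two points beyond a common threshold. -/
theorem IsHazardRate.tail_eq_mul_exp {F : Measure ℝ} {h : ℝ → ℝ} (H : IsHazardRate F h) :
    ∃ t₀ : ℝ, 0 < tail F t₀ ∧ ∀ x y, t₀ ≤ x → x ≤ y → IntervalIntegrable h volume x y ∧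
      tail F y = tail F x * Real.exp (-∫ u in x..y, h u) := by
  obtain ⟨t₀, h0, H⟩ := H
  refine ⟨t₀, h0, fun x y hx hxy => ?_⟩
  obtain ⟨ix, ex⟩ := H x hx
  obtain ⟨iy, ey⟩ := H y (hx.trans hxy)
  have ixy : IntervalIntegrable h volume x y := ix.symm.trans iy
  refine ⟨ixy, ?_⟩
  rw [ey, ex, ← intervalIntegral.integral_add_adjacent_intervals ix ixy, neg_add, Real.exp_add,
    mul_assoc]

/-- The growth properties of a tail `f` that the argument uses: `f` decays faster than every power
(`rapid`), a dilation of the argument changes it by less than any power (`slow`), and it is nearly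
constant at scales below `x ^ (3 / 4)` (`smooth`). -/
structure ModerateTail (f : ℝ → ℝ) : Prop where
  antitone : Antitone f
  pos : ∀ t, 0 < f t
  rapid : ∀ p : ℕ, ∀ᶠ s in atTop, ∀ l : ℝ, 1 ≤ l → l ^ p * f (l * s) ≤ f s
  slow : ∀ ε : ℝ, 0 < ε → ∀ a b : ℝ, 0 < a → 0 < b →
    (fun t : ℝ => t ^ (-ε) * f (a * t)) =o[atTop] fun t => f (b * t)
  smooth : ∀ᶠ x in atTop, ∀ y, x ≤ y → f x - f y ≤ f x * ((y - x) * x ^ (-(3 / 4) : ℝ))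

theorem IsHazardRate.tail_pos {F : Measure ℝ} [IsFiniteMeasure F] {h : ℝ → ℝ}
    (H : IsHazardRate F h) (t : ℝ) : 0 < tail F t := by
  obtain ⟨t₀, h0, H⟩ := H
  refine lt_of_lt_of_le ?_ (tail_antitone F (le_max_left t t₀))
  rw [(H _ (le_max_right t t₀)).2]
  positivity

theorem IsHazardRate.rapid {F : Measure ℝ} [IsFiniteMeasure F] {h : ℝ → ℝ}
    (H : IsHazardRate F h) (ht : Tendsto (fun t => t * h t) atTop atTop) (p : ℕ) :
    ∀ᶠ s in atTop, ∀ l : ℝ, 1 ≤ l → l ^ p * tail F (l * s) ≤ tail F s := by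
  obtain ⟨t₀, -, Hr⟩ := H.tail_eq_mul_exp
  obtain ⟨u₀, hu₀⟩ := eventually_atTop.1 (ht.eventually_ge_atTop (p : ℝ))
  filter_upwards [eventually_ge_atTop t₀, eventually_ge_atTop u₀, eventually_gt_atTop 0]
    with s hs1 hs2 hs l hl
  have hsl : s ≤ l * s := le_mul_of_one_le_left hs.le hl
  obtain ⟨hi, he⟩ := Hr s (l * s) hs1 hsl
  have hii : IntervalIntegrable (fun u : ℝ => (p : ℝ) * u⁻¹) volume s (l * s) := by
    refine (intervalIntegral.intervalIntegrable_inv (fun u hu => ?_) continuousOn_id).const_mul _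
    rw [Set.uIcc_of_le hsl] at hu
    exact (hs.trans_le hu.1).ne'
  have hint : (p : ℝ) * Real.log l ≤ ∫ u in s..(l * s), h u := by
    calc (p : ℝ) * Real.log l = ∫ u in s..(l * s), (p : ℝ) * u⁻¹ := by
          rw [intervalIntegral.integral_const_mul, integral_inv_of_pos hs (hs.trans_le hsl),
            mul_div_cancel_right₀ _ hs.ne']
      _ ≤ _ := by
          refine intervalIntegral.integral_mono_on hsl hii hi fun u hu => ?_
          have hu0 : 0 < u := hs.trans_le hu.1
          have := hu₀ u (hs2.trans hu.1)
          rw [← div_eq_mul_inv, div_le_iff₀ hu0]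
          linarith
  have hl0 : 0 < l := one_pos.trans_le hl
  calc l ^ p * tail F (l * s) = tail F s * (l ^ p * Real.exp (-∫ u in s..(l * s), h u)) := by
        rw [he]; ring
    _ ≤ tail F s * 1 := by
        refine mul_le_mul_of_nonneg_left ?_ (H.tail_pos s).le
        have e : l ^ p = Real.exp ((p : ℝ) * Real.log l) := by
          rw [mul_comm, Real.exp_mul, Real.exp_log hl0, Real.rpow_natCast]
        rw [e, ← Real.exp_add, Real.exp_le_one_iff]
        linarith
    _ = _ := mul_one _

theorem IsHazardRate.slow {F : Measure ℝ} [IsFiniteMeasure F] {h : ℝ → ℝ}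
    (H : IsHazardRate F h) (ho : h =o[atTop] fun t => t⁻¹ * Real.log t)
    {ε a b : ℝ} (hε : 0 < ε) (ha : 0 < a) (hb : 0 < b) :
    (fun t : ℝ => t ^ (-ε) * tail F (a * t)) =o[atTop] fun t => tail F (b * t) := by
  have key : ∃ C : ℝ, 0 < C ∧ ∀ᶠ t in atTop,
      tail F (a * t) ≤ C * t ^ (ε / 2) * tail F (b * t) := by
    rcases le_or_gt b a with hba | hab
    · refine ⟨1, one_pos, ?_⟩
      filter_upwards [eventually_ge_atTop 1] with t ht
      have h1 : tail F (a * t) ≤ tail F (b * t) := tail_antitone F (by gcongr)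
      have h2 : 1 ≤ t ^ (ε / 2) := Real.one_le_rpow ht (by positivity)
      nlinarith [H.tail_pos (b * t)]
    · obtain ⟨t₀, -, Hr⟩ := H.tail_eq_mul_exp
      -- chosen so that the hazard integrated over `[a t, b t]` is at most `(ε / 2) log (b t)`
      set e := ε / 2 * (a / (b - a)) with he_def
      have hba : 0 < b - a := sub_pos.2 hab
      have he : 0 < e := by positivity
      obtain ⟨u₀, hu₀⟩ := eventually_atTop.1 (ho.def he)
      refine ⟨b ^ (ε / 2), by positivity, ?_⟩
      have hat : Tendsto (fun t : ℝ => a * t) atTop atTop := tendsto_id.const_mul_atTop ha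
      filter_upwards [hat.eventually_ge_atTop t₀, hat.eventually_ge_atTop u₀,
        hat.eventually_ge_atTop 1, eventually_gt_atTop 0] with t h1 h2 h3 ht
      have hle : a * t ≤ b * t := by gcongr
      obtain ⟨hi, heq⟩ := Hr (a * t) (b * t) h1 hle
      have hint : ∫ u in (a * t)..(b * t), h u ≤ ε / 2 * Real.log (b * t) := by
        calc ∫ u in (a * t)..(b * t), h u
            ≤ ∫ u in (a * t)..(b * t), e * ((a * t)⁻¹ * Real.log (b * t)) := by
              refine intervalIntegral.integral_mono_on hle hi (by simp) fun u hu => ?_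
              have hu1 : 1 ≤ u := h3.trans hu.1
              have hlog : 0 ≤ Real.log u := Real.log_nonneg hu1
              have := hu₀ u (h2.trans hu.1)
              rw [Real.norm_eq_abs, Real.norm_eq_abs, abs_of_nonneg (a := u⁻¹ * _) (by positivity)]
                at this
              refine (le_abs_self _).trans (this.trans ?_)
              have := hu.1
              have := hu.2
              gcongr
          _ = ε / 2 * Real.log (b * t) := by
              rw [intervalIntegral.integral_const, smul_eq_mul, he_def]
              field_simp
      have hbt : 0 < b * t := by positivity
      have hexp : Real.exp (∫ u in (a * t)..(b * t), h u) ≤ b ^ (ε / 2) * t ^ (ε / 2) := by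
        rw [← Real.mul_rpow hb.le ht.le, Real.rpow_def_of_pos hbt, Real.exp_le_exp]
        linarith
      calc tail F (a * t)
          = Real.exp (∫ u in (a * t)..(b * t), h u) * tail F (b * t) := by
            rw [heq, mul_left_comm, ← Real.exp_add]; simp
        _ ≤ _ := mul_le_mul_of_nonneg_right hexp (H.tail_pos _).le
  obtain ⟨C, hC, hk⟩ := key
  have h1 : (fun t : ℝ => t ^ (-ε) * tail F (a * t)) =O[atTop]
      fun t => t ^ (-(ε / 2)) * tail F (b * t) := by
    refine IsBigO.of_bound C ?_
    filter_upwards [hk, eventually_gt_atTop 0] with t h1 ht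
    have p1 := H.tail_pos (a * t)
    have p2 := H.tail_pos (b * t)
    rw [Real.norm_of_nonneg (by positivity), Real.norm_of_nonneg (by positivity)]
    have e : t ^ (-(ε / 2)) = t ^ (-ε) * t ^ (ε / 2) := by
      rw [← Real.rpow_add ht]; ring_nf
    rw [e]
    calc t ^ (-ε) * tail F (a * t) ≤ t ^ (-ε) * (C * t ^ (ε / 2) * tail F (b * t)) := by gcongr
      _ = _ := by ring
  refine h1.trans_isLittleO ?_
  have h2 : (fun t : ℝ => t ^ (-(ε / 2))) =o[atTop] fun _ => (1 : ℝ) :=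
    (isLittleO_one_iff ℝ).2 (tendsto_rpow_neg_atTop (by positivity))
  simpa using h2.mul_isBigO (isBigO_refl (fun t => tail F (b * t)) atTop)

theorem IsHazardRate.smooth {F : Measure ℝ} [IsFiniteMeasure F] {h : ℝ → ℝ}
    (H : IsHazardRate F h) (ho : h =o[atTop] fun t => t⁻¹ * Real.log t) :
    ∀ᶠ x in atTop, ∀ y, x ≤ y →
      tail F x - tail F y ≤ tail F x * ((y - x) * x ^ (-(3 / 4) : ℝ)) := by
  obtain ⟨t₀, -, Hr⟩ := H.tail_eq_mul_exp
  have h1 : h =o[atTop] fun t => t⁻¹ * t ^ (1 / 4 : ℝ) :=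
    ho.trans_isBigO ((isBigO_refl _ _).mul (isLittleO_log_rpow_atTop (by norm_num)).isBigO)
  obtain ⟨u₀, hu₀⟩ := eventually_atTop.1 (h1.def one_pos)
  filter_upwards [eventually_ge_atTop t₀, eventually_ge_atTop u₀, eventually_gt_atTop 0]
    with x hx1 hx2 hx y hxy
  obtain ⟨hi, he⟩ := Hr x y hx1 hxy
  have hint : ∫ u in x..y, h u ≤ (y - x) * x ^ (-(3 / 4) : ℝ) := by
    calc ∫ u in x..y, h u ≤ ∫ u in x..y, x ^ (-(3 / 4) : ℝ) := by
          refine intervalIntegral.integral_mono_on hxy hi (by simp) fun u hu => ?_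
          have hu0 : 0 < u := hx.trans_le hu.1
          have := hu₀ u (hx2.trans hu.1)
          rw [Real.norm_eq_abs, Real.norm_eq_abs, abs_of_nonneg (a := u⁻¹ * _) (by positivity),
            one_mul] at this
          refine (le_abs_self _).trans (this.trans ?_)
          rw [← Real.rpow_neg_one, ← Real.rpow_add hu0]
          norm_num only
          exact Real.rpow_le_rpow_of_nonpos hx hu.1 (by norm_num)
      _ = _ := by rw [intervalIntegral.integral_const, smul_eq_mul]
  have hexp := Real.add_one_le_exp (-∫ u in x..y, h u)
  rw [he]
  have := H.tail_pos x
  have : tail F x - tail F x * Real.exp (-∫ u in x..y, h u)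
      = tail F x * (1 - Real.exp (-∫ u in x..y, h u)) := by ring
  rw [this]
  gcongr
  linarith

theorem IsHazardRate.moderateTail {F : Measure ℝ} [IsFiniteMeasure F] {h : ℝ → ℝ}
    (H : IsHazardRate F h) (hc : HazardConditions h) : ModerateTail (tail F) where
  antitone := tail_antitone F
  pos := H.tail_pos
  rapid := H.rapid hc.tendsto_mul
  slow _ hε _ _ ha hb := H.slow hc.isLittleO hε ha hb
  smooth := H.smooth hc.isLittleO

/-- Rapid variation: among positive weights, the smaller one has the negligible tail. -/
theorem ModerateTail.isLittleO_of_lt {f : ℝ → ℝ} (hf : ModerateTail f) {a b : ℝ} (ha : 0 < a)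
    (hab : a < b) : (fun t => f (b * t)) =o[atTop] fun t => f (a * t) := by
  refine IsLittleO.of_bound fun ε hε => ?_
  have hl : 1 < b / a := (one_lt_div ha).2 hab
  obtain ⟨p, hp⟩ := exists_pow_lt_of_lt_one hε (inv_lt_one_of_one_lt₀ hl)
  have hat : Tendsto (fun t : ℝ => a * t) atTop atTop := tendsto_id.const_mul_atTop ha
  filter_upwards [hat.eventually (hf.rapid p)] with t ht
  have := ht (b / a) hl.le
  rw [show b / a * (a * t) = b * t by field_simp] at this
  rw [Real.norm_of_nonneg (hf.pos _).le, Real.norm_of_nonneg (hf.pos _).le]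
  have hpos : 0 < (b / a) ^ p := by positivity
  calc f (b * t) = ((b / a)⁻¹) ^ p * ((b / a) ^ p * f (b * t)) := by
        rw [inv_pow]; field_simp
    _ ≤ ε * f (a * t) := by
        gcongr
        exact mul_nonneg hpos.le (hf.pos _).le

/-- If `u t ≤ g t + k t * u (θ t)` with `θ < 1`, where `g` is negligible against `q` and so is
`k t * q (θ t)`, then `u` is negligible against `q`: iterating the recursion gives `u = O(q)`, and
one more application improves this to `o(q)`. -/
theorem isLittleO_of_contraction {u q g k : ℝ → ℝ} {θ : ℝ} (hθ : 0 < θ) (hθ1 : θ < 1)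
    (hu0 : ∀ t, 0 ≤ u t) (hu1 : ∀ t, u t ≤ 1) (hq : Antitone q) (hqpos : ∀ t, 0 < q t)
    (hrec : ∀ᶠ t in atTop, u t ≤ g t + k t * u (θ * t))
    (hg : g =o[atTop] q) (hk : (fun t => k t * q (θ * t)) =o[atTop] q)
    (hk0 : ∀ᶠ t in atTop, 0 ≤ k t) : u =o[atTop] q := by
  have hO : u =O[atTop] q := by
    obtain ⟨t₁, ht₁⟩ := eventually_atTop.1 ((((hrec.and hk0).and
      (hg.def one_pos)).and (hk.def (half_pos one_pos))).and (eventually_gt_atTop 0))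
    have ht1 : 0 < t₁ := (ht₁ t₁ le_rfl).2
    set B := max 2 (1 / q t₁)
    have hB2 : 2 ≤ B := le_max_left _ _
    have hBq : 1 ≤ B * q t₁ := by
      rw [← div_le_iff₀ (hqpos _)]; exact le_max_right _ _
    -- `n` counts the dilations by `θ` that bring `t` back below `t₁`
    have hind : ∀ n : ℕ, ∀ t, θ * t₁ ≤ t → θ ^ n * t ≤ t₁ → u t ≤ B * q t := by
      intro n
      induction n with
      | zero =>
        intro t _ h2
        simp only [pow_zero, one_mul] at h2
        have := hq h2
        nlinarith [hu1 t]
      | succ n ih =>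
        intro t h1 h2
        rcases le_total t t₁ with h | h
        · have := hq h
          nlinarith [hu1 t]
        · obtain ⟨⟨⟨⟨r1, r2⟩, r3⟩, r4⟩, r5⟩ := ht₁ t h
          have hi := ih (θ * t) (by gcongr) (by rw [← mul_assoc, ← pow_succ]; exact h2)
          rw [Real.norm_eq_abs, Real.norm_of_nonneg (hqpos _).le, one_mul] at r3
          rw [Real.norm_of_nonneg (mul_nonneg r2 (hqpos _).le),
            Real.norm_of_nonneg (hqpos _).le] at r4
          have r3' := (le_abs_self _).trans r3
          have := mul_le_mul_of_nonneg_left hi r2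
          nlinarith [hqpos t]
    refine IsBigO.of_bound B ?_
    filter_upwards [eventually_ge_atTop (θ * t₁), eventually_gt_atTop 0] with t h1 h2
    obtain ⟨n, hn⟩ := exists_pow_lt_of_lt_one (div_pos ht1 h2) hθ1
    rw [Real.norm_of_nonneg (hu0 t), Real.norm_of_nonneg (hqpos _).le]
    exact hind n t h1 ((lt_div_iff₀ h2).1 hn).le
  have hθt : Tendsto (fun t : ℝ => θ * t) atTop atTop := tendsto_id.const_mul_atTop hθ
  have h2 : (fun t => g t + k t * u (θ * t)) =o[atTop] q :=
    hg.add (((isBigO_refl k atTop).mul (hO.comp_tendsto hθt)).trans_isLittleO hk)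
  refine IsBigO.trans_isLittleO (IsBigO.of_bound 1 ?_) h2
  filter_upwards [hrec] with t ht
  rw [Real.norm_of_nonneg (hu0 t), one_mul]
  exact ht.trans (Real.le_norm_self _)

/-! ### A maximal inequality for series of nonnegative independent variables -/

/-- Functions of disjoint, possibly infinite, subfamilies of an independent family are
independent. -/
theorem indepFun_of_disjoint {Ω : Type*} [MeasurableSpace Ω] {ι β γ γ' : Type*}
    [MeasurableSpace β] [MeasurableSpace γ] [MeasurableSpace γ'] {P : Measure Ω}
    {Y : ι → Ω → β} (hY : ∀ i, Measurable (Y i)) (hind : iIndepFun Y P)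
    {S T : Set ι} (hST : Disjoint S T) {U : Ω → γ} {V : Ω → γ'}
    (hU : Measurable[⨆ i ∈ S, MeasurableSpace.comap (Y i) inferInstance] U)
    (hV : Measurable[⨆ i ∈ T, MeasurableSpace.comap (Y i) inferInstance] V) :
    IndepFun U V P := by
  have h := indep_iSup_of_disjoint (fun i => (hY i).comap_le) hind.iIndep hST
  rw [IndepFun_iff_Indep]
  exact indep_of_indep_of_le_left (indep_of_indep_of_le_right h hV.comap_le) hU.comap_le

theorem measurable_of_mem_iSup_comap {Ω ι β : Type*} [MeasurableSpace β] {Y : ι → Ω → β}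
    {S : Set ι} {i : ι} (hi : i ∈ S) :
    Measurable[⨆ i ∈ S, MeasurableSpace.comap (Y i) inferInstance] (Y i) :=
  measurable_iff_comap_le.2 (le_iSup₂ (f := fun i (_ : i ∈ S) =>
    MeasurableSpace.comap (Y i) inferInstance) i hi)

theorem measurable_tsum_ennreal {Ω ι : Type*} [Countable ι] {m : MeasurableSpace Ω}
    {Z : ι → Ω → ℝ≥0∞} (hZ : ∀ i, Measurable (Z i)) : Measurable fun ω => ∑' i, Z i ω :=
  Measurable.tsum hZ

/-- A Hoffmann-Jørgensen type inequality. Let `n` be the first index for which the partial sum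
including `Z n` exceeds `a`. If `Z n ≤ y`, this partial sum is at most `a + y`, so the terms after
`n`, which are independent of the first ones, must add up to more than `b`. -/
theorem measure_lt_tsum_nat_le {Ω : Type*} [MeasurableSpace Ω] (P : Measure Ω)
    {Z : ℕ → Ω → ℝ≥0∞} (hZ : ∀ n, Measurable (Z n))
    (hind : iIndepFun Z P) (a y b : ℝ≥0∞) :
    P {ω | a + y + b < ∑' n, Z n ω} ≤
      ∑' n, P {ω | y < Z n ω} + P {ω | a < ∑' n, Z n ω} * P {ω | b < ∑' n, Z n ω} := by
  -- `A n` is the event that the partial sums first exceed `a` when the term `Z n` is added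
  set A : ℕ → Set Ω := fun n =>
    {ω | ∑ k ∈ Finset.range n, Z k ω ≤ a ∧ a < ∑ k ∈ Finset.range (n + 1), Z k ω} with hA
  set V : ℕ → Ω → ℝ≥0∞ := fun n ω => ∑' k, Z (k + (n + 1)) ω with hV
  have hsumm : ∀ n, Measurable fun ω => ∑ k ∈ Finset.range n, Z k ω := fun n =>
    Finset.measurable_fun_sum _ fun k _ => hZ k
  have hAm : ∀ n, MeasurableSet (A n) := fun n =>
    (measurableSet_le (hsumm n) measurable_const).inter
      (measurableSet_lt measurable_const (hsumm (n + 1)))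
  have hmono : ∀ ω, Monotone fun n => ∑ k ∈ Finset.range n, Z k ω := fun ω m n hmn =>
    Finset.sum_le_sum_of_subset (Finset.range_mono hmn)
  have hdisj : Pairwise (Function.onFun Disjoint A) := by
    have : ∀ m n, m < n → Disjoint (A m) (A n) := by
      intro m n hmn
      rw [Set.disjoint_left]
      intro ω h1 h2
      exact absurd (h1.2.trans_le (hmono ω hmn)) (not_lt.2 h2.1)
    intro m n hmn
    rcases lt_or_gt_of_ne hmn with h | h
    · exact this m n h
    · exact (this n m h).symm
  have hcov : {ω | a + y + b < ∑' n, Z n ω} ⊆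
      (⋃ n, {ω | y < Z n ω}) ∪ ⋃ n, (A n ∩ {ω | b < V n ω}) := by
    intro ω hω
    by_cases hy : ∃ n, y < Z n ω
    · exact Or.inl (Set.mem_iUnion.2 hy)
    push Not at hy
    right
    have hlt : a < ∑' n, Z n ω := lt_of_le_of_lt (le_add_right (le_add_right le_rfl)) hω
    have hex : ∃ n, a < ∑ k ∈ Finset.range n, Z k ω := by
      rw [ENNReal.tsum_eq_iSup_nat] at hlt
      exact lt_iSup_iff.1 hlt
    classical
    obtain ⟨n, hn⟩ : ∃ n, Nat.find hex = n + 1 := by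
      refine Nat.exists_eq_succ_of_ne_zero fun h0 => ?_
      have := Nat.find_spec hex
      rw [h0] at this
      simp at this
    have h2 := Nat.find_spec hex
    rw [hn] at h2
    have h1 : ∑ k ∈ Finset.range n, Z k ω ≤ a := by
      have := Nat.find_min hex (m := n) (by omega)
      exact not_lt.1 this
    refine Set.mem_iUnion.2 ⟨n, ⟨h1, h2⟩, ?_⟩
    have hsplit : ∑ k ∈ Finset.range (n + 1), Z k ω + V n ω = ∑' k, Z k ω :=
      ENNReal.summable.sum_add_tsum_nat_add' (f := fun k => Z k ω)
    by_contra hb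
    have hb' : V n ω ≤ b := not_lt.1 hb
    have hω' : a + y + b < ∑' n, Z n ω := hω
    refine absurd hω' (not_lt.2 ?_)
    rw [← hsplit, Finset.sum_range_succ]
    exact add_le_add (add_le_add h1 (hy n)) hb'
  have hindep : ∀ n, P (A n ∩ {ω | b < V n ω}) = P (A n) * P {ω | b < V n ω} := by
    intro n
    have hmA : ∀ m ≤ n + 1,
        Measurable[⨆ i ∈ Set.Iio (n + 1), MeasurableSpace.comap (Z i) inferInstance]
        (fun ω => ∑ k ∈ Finset.range m, Z k ω) := by
      intro m hm
      refine Finset.measurable_fun_sum _ fun k hk => ?_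
      exact measurable_of_mem_iSup_comap (Set.mem_Iio.2 (by have := Finset.mem_range.1 hk; omega))
    have hmV : Measurable[⨆ i ∈ Set.Ici (n + 1), MeasurableSpace.comap (Z i) inferInstance]
        (V n) := by
      refine measurable_tsum_ennreal fun k => ?_
      exact measurable_of_mem_iSup_comap (Set.mem_Ici.2 (by omega))
    have hi : IndepFun (fun ω => (∑ k ∈ Finset.range n, Z k ω,
        ∑ k ∈ Finset.range (n + 1), Z k ω)) (V n) P :=
      indepFun_of_disjoint hZ hind (Set.Iio_disjoint_Ici le_rfl)
        ((hmA n (by omega)).prodMk (hmA (n + 1) le_rfl)) hmV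
    exact hi.measure_inter_preimage_eq_mul {p | p.1 ≤ a ∧ a < p.2} (Set.Ioi b)
      ((measurableSet_le measurable_fst measurable_const).inter
        (measurableSet_lt measurable_const measurable_snd)) measurableSet_Ioi
  have hVle : ∀ n, P {ω | b < V n ω} ≤ P {ω | b < ∑' k, Z k ω} := by
    intro n
    refine measure_mono fun ω (hω : b < V n ω) => hω.trans_le ?_
    exact ENNReal.tsum_comp_le_tsum_of_injective (add_left_injective (n + 1)) fun k => Z k ω
  have hAle : ∑' n, P (A n) ≤ P {ω | a < ∑' k, Z k ω} := by
    rw [← measure_iUnion hdisj hAm]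
    refine measure_mono (Set.iUnion_subset fun n ω hω => ?_)
    exact lt_of_lt_of_le hω.2 (ENNReal.sum_le_tsum _)
  calc P {ω | a + y + b < ∑' n, Z n ω}
      ≤ P (⋃ n, {ω | y < Z n ω}) + P (⋃ n, (A n ∩ {ω | b < V n ω})) :=
        (measure_mono hcov).trans (measure_union_le _ _)
    _ ≤ ∑' n, P {ω | y < Z n ω} + ∑' n, P (A n ∩ {ω | b < V n ω}) :=
        add_le_add (measure_iUnion_le _) (measure_iUnion_le _)
    _ ≤ ∑' n, P {ω | y < Z n ω} + ∑' n, P (A n) * P {ω | b < ∑' k, Z k ω} := by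
        refine add_le_add le_rfl (ENNReal.tsum_le_tsum fun n => ?_)
        rw [hindep]
        exact mul_le_mul_right (hVle n) _
    _ ≤ _ := by
        rw [ENNReal.tsum_mul_right]
        gcongr

theorem measure_lt_tsum_le {Ω ι : Type*} [MeasurableSpace Ω] [Denumerable ι] (P : Measure Ω)
    {Z : ι → Ω → ℝ≥0∞} (hZ : ∀ i, Measurable (Z i)) (hind : iIndepFun Z P) (a y b : ℝ≥0∞) :
    P {ω | a + y + b < ∑' i, Z i ω} ≤
      ∑' i, P {ω | y < Z i ω} + P {ω | a < ∑' i, Z i ω} * P {ω | b < ∑' i, Z i ω} := by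
  set e := (Denumerable.eqv ι).symm
  have h := measure_lt_tsum_nat_le P (Z := fun n => Z (e n)) (fun n => hZ _)
    (hind.precomp e.injective) a y b
  simp only [fun ω => e.tsum_eq (fun i => Z i ω), e.tsum_eq (fun i => P {ω | y < Z i ω})] at h
  exact h

/-! ### The contribution of the small weights -/

theorem ofReal_lt_enorm_iff {t x : ℝ} (ht : 0 ≤ t) : ENNReal.ofReal t < ‖x‖ₑ ↔ t < |x| := by
  rw [← ofReal_norm, ENNReal.ofReal_lt_ofReal_iff_of_nonneg ht, Real.norm_eq_abs]

/-- A two-sided tail bounded by a moderate one has a finite first moment. -/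
theorem lintegral_enorm_lt_top {F : Measure ℝ} [IsProbabilityMeasure F]
    (hf : ModerateTail (tail F))
    (habs : (fun t => F.real {x | t < |x|}) =O[atTop] tail F) : ∫⁻ x, ‖x‖ₑ ∂F < ∞ := by
  obtain ⟨C, hC, hCb⟩ := habs.exists_pos
  obtain ⟨s, hs2, hs1⟩ := ((hf.rapid 2).and (eventually_ge_atTop 1)).exists
  have hs0 : 0 < s := one_pos.trans_le hs1
  obtain ⟨t₁, ht₁⟩ := eventually_atTop.1 (hCb.bound.and (eventually_ge_atTop s))
  have ht10 : 0 < t₁ := hs0.trans_le (ht₁ t₁ le_rfl).2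
  have hbd : ∀ t, t₁ ≤ t → F {x | t < |x|} ≤ ENNReal.ofReal (C * s ^ 2 * t ^ (-2 : ℝ)) := by
    intro t ht
    obtain ⟨h1, h2⟩ := ht₁ t ht
    have ht0 : 0 < t := ht10.trans_le ht
    rw [Real.norm_of_nonneg measureReal_nonneg, Real.norm_of_nonneg (hf.pos _).le] at h1
    have h3 := hs2 (t / s) ((one_le_div hs0).2 h2)
    rw [div_mul_cancel₀ _ hs0.ne'] at h3
    have h4 : tail F s ≤ 1 := measureReal_le_one
    rw [← ENNReal.ofReal_toReal (measure_ne_top F {x | t < |x|})]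
    refine ENNReal.ofReal_le_ofReal (h1.trans ?_)
    rw [mul_assoc]
    refine mul_le_mul_of_nonneg_left ?_ hC.le
    have e : t ^ (-2 : ℝ) = (t ^ 2)⁻¹ := by
      rw [Real.rpow_neg ht0.le]; norm_cast
    rw [e, ← div_eq_mul_inv, le_div_iff₀ (by positivity)]
    rw [div_pow, div_mul_eq_mul_div, div_le_iff₀ (by positivity)] at h3
    nlinarith [pow_pos hs0 2]
  have e1 : ∫⁻ x, ‖x‖ₑ ∂F = ∫⁻ t in Set.Ioi 0, F {x | t < |x|} := by
    rw [← lintegral_eq_lintegral_meas_lt F (Eventually.of_forall fun x => abs_nonneg x)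
      (measurable_id.abs).aemeasurable]
    simp only [← ofReal_norm, Real.norm_eq_abs]
  rw [e1, ← Set.Ioc_union_Ioi_eq_Ioi ht10.le]
  refine (lintegral_union_le _ _ _).trans_lt (ENNReal.add_lt_top.2 ⟨?_, ?_⟩)
  · refine (lintegral_mono fun t => prob_le_one).trans_lt ?_
    simp
  · refine (setLIntegral_mono' measurableSet_Ioi fun t ht => hbd t (le_of_lt ht)).trans_lt ?_
    have hi : IntegrableOn (fun t : ℝ => C * s ^ 2 * t ^ (-2 : ℝ)) (Set.Ioi t₁) :=
      (integrableOn_Ioi_rpow_of_lt (by norm_num) ht10).const_mul _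
    refine lt_of_le_of_lt (lintegral_mono fun t => ?_) hi.hasFiniteIntegral
    rw [← ofReal_norm]
    exact ENNReal.ofReal_le_ofReal (le_abs_self _)

/-- A bound for the tails of all `c X` with `|c| ≤ κ` which is uniform in `c` and linear in `|c|`,
hence summable over the weights. -/
theorem exists_measure_enorm_mul_le {F : Measure ℝ} [IsProbabilityMeasure F]
    (hf : ModerateTail (tail F))
    (habs : (fun t => F.real {x | t < |x|}) =O[atTop] tail F) :
    ∃ K s₀ : ℝ, 0 < K ∧ ∀ c κ t : ℝ, 0 < κ → |c| ≤ κ → 0 ≤ t → s₀ ≤ κ⁻¹ * t →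
      F {x | ENNReal.ofReal t < ‖c * x‖ₑ} ≤
        ENNReal.ofReal (K * (κ⁻¹ * |c|) * tail F (κ⁻¹ * t)) := by
  obtain ⟨K, hK, hKb⟩ := habs.exists_pos
  obtain ⟨s₀, hs₀⟩ := eventually_atTop.1 (hKb.bound.and ((hf.rapid 1).and
    (eventually_gt_atTop 0)))
  refine ⟨K, s₀, hK, fun c κ t hκ hc ht0 hst => ?_⟩
  rcases eq_or_ne c 0 with rfl | hc0
  · simp
  have hcp : 0 < |c| := abs_pos.2 hc0
  have hst0 : 0 < κ⁻¹ * t := (hs₀ _ hst).2.2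
  have hset : {x : ℝ | ENNReal.ofReal t < ‖c * x‖ₑ} = {x | t / |c| < |x|} := by
    ext x
    change ENNReal.ofReal t < ‖c * x‖ₑ ↔ t / |c| < |x|
    rw [ofReal_lt_enorm_iff ht0, abs_mul, div_lt_iff₀' hcp]
  have hl : κ⁻¹ * t ≤ t / |c| := by
    rw [div_eq_inv_mul]; gcongr
  have h1 := (hs₀ (t / |c|) (hst.trans hl)).1
  rw [Real.norm_of_nonneg measureReal_nonneg, Real.norm_of_nonneg (hf.pos _).le] at h1
  have h2 := (hs₀ _ hst).2.1 (κ / |c|) ((one_le_div hcp).2 hc)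
  rw [show κ / |c| * (κ⁻¹ * t) = t / |c| by field_simp, pow_one] at h2
  rw [hset, ← ENNReal.ofReal_toReal (measure_ne_top F {x | t / |c| < |x|})]
  refine ENNReal.ofReal_le_ofReal (h1.trans ?_)
  rw [mul_assoc]
  refine mul_le_mul_of_nonneg_left ?_ hK.le
  rw [inv_mul_eq_div, div_mul_eq_mul_div, le_div_iff₀ hκ]
  rw [div_mul_eq_mul_div, div_le_iff₀ hcp] at h2
  linarith

/-- Markov's inequality for an extended nonnegative variable, in terms of real numbers. -/
theorem measureReal_ofReal_lt_le {Ω : Type*} [MeasurableSpace Ω] {P : Measure Ω}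
    {T : Ω → ℝ≥0∞} (hT : AEMeasurable T P) (hfin : ∫⁻ ω, T ω ∂P < ∞) {t : ℝ} (ht : 0 < t) :
    P.real {ω | ENNReal.ofReal t < T ω} ≤ (∫⁻ ω, T ω ∂P).toReal * t⁻¹ := by
  have h1 : P {ω | ENNReal.ofReal t < T ω} ≤ (∫⁻ ω, T ω ∂P) / ENNReal.ofReal t :=
    (measure_mono fun ω (hω : ENNReal.ofReal t < T ω) =>
      show ENNReal.ofReal t ≤ T ω from hω.le).trans
      (meas_ge_le_lintegral_div hT (by simpa using ht) ENNReal.ofReal_ne_top)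
  have h2 := ENNReal.toReal_mono (ENNReal.div_lt_top hfin.ne (by simpa using ht)).ne h1
  rwa [ENNReal.toReal_div, ENNReal.toReal_ofReal ht.le, div_eq_mul_inv] at h2

theorem lintegral_tsum_enorm_lt_top {Ω : Type*} [MeasurableSpace Ω] {P : Measure Ω}
    {F : Measure ℝ} [IsProbabilityMeasure F] (hf : ModerateTail (tail F))
    (habs : (fun t => F.real {x | t < |x|}) =O[atTop] tail F)
    {ι : Type*} [Countable ι] {X : ι → Ω → ℝ} (hlaw : ∀ i, HasLaw (X i) F P)
    {c : ι → ℝ} (hc : Summable fun i => |c i|) :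
    ∫⁻ ω, ∑' i, ‖c i * X i ω‖ₑ ∂P < ∞ := by
  rw [lintegral_tsum fun i => ((hlaw i).aemeasurable.const_mul (c i)).enorm]
  have e : ∀ i, ∫⁻ ω, ‖c i * X i ω‖ₑ ∂P = ENNReal.ofReal |c i| * ∫⁻ x, ‖x‖ₑ ∂F := by
    intro i
    simp only [enorm_mul]
    rw [lintegral_const_mul' _ _ enorm_ne_top, ← (hlaw i).map_eq,
      lintegral_map' measurable_enorm.aemeasurable (hlaw i).aemeasurable,
      ← ofReal_norm, Real.norm_eq_abs]
  simp only [e]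
  rw [ENNReal.tsum_mul_right, ← ENNReal.ofReal_tsum_of_nonneg (fun i => abs_nonneg _) hc]
  exact ENNReal.mul_lt_top ENNReal.ofReal_lt_top (lintegral_enorm_lt_top hf habs)

/-- If the weights are bounded by some `κ' < κ`, the tail of `∑ |c i X i|` is negligible against
that of `κ X`. -/
theorem isLittleO_measureReal_tsum_enorm {Ω : Type*} [MeasurableSpace Ω] {P : Measure Ω}
    [IsProbabilityMeasure P] {F : Measure ℝ} [IsProbabilityMeasure F]
    (hf : ModerateTail (tail F))
    (habs : (fun t => F.real {x | t < |x|}) =O[atTop] tail F)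
    {ι : Type*} [Denumerable ι] {X : ι → Ω → ℝ} (hX : ∀ i, Measurable (X i))
    (hlaw : ∀ i, HasLaw (X i) F P) (hind : iIndepFun X P)
    {c : ι → ℝ} (hc : Summable fun i => |c i|) {κ' κ : ℝ} (hκ' : 0 < κ') (hκ : κ' < κ)
    (hcκ : ∀ i, |c i| ≤ κ') :
    (fun t : ℝ => P.real {ω | ENNReal.ofReal t < ∑' i, ‖c i * X i ω‖ₑ})
      =o[atTop] fun t => tail F (κ⁻¹ * t) := by
  have hκ0 : 0 < κ := hκ'.trans hκ
  obtain ⟨K, s₀, hK, hKb⟩ := exists_measure_enorm_mul_le hf habs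
  set A := (∫⁻ ω, ∑' i, ‖c i * X i ω‖ₑ ∂P).toReal with hA
  have hZ : ∀ i, Measurable fun ω => ‖c i * X i ω‖ₑ := fun i => ((hX i).const_mul _).enorm
  have hfin := lintegral_tsum_enorm_lt_top hf habs hlaw hc
  -- the level `ρ κ' t < t` for a single term: since `ρ > 1 / κ`, even the largest weight `κ'` gives
  -- a tail of order `f (ρ t) = o(f (t / κ))` there
  obtain ⟨ρ, hρ1, hρ2⟩ := exists_between (inv_strictAnti₀ hκ' hκ)
  have hρ0 : 0 < ρ := (inv_pos.2 hκ0).trans hρ1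
  have hρκ : ρ * κ' < 1 := by
    have := mul_lt_mul_of_pos_right hρ2 hκ'
    rwa [inv_mul_cancel₀ hκ'.ne'] at this
  set θ := (1 - ρ * κ') / 2 with hθ_def
  have hθ : 0 < θ := by rw [hθ_def]; linarith
  have hρκ0 : 0 < ρ * κ' := by positivity
  have hθ1 : θ < 1 := by rw [hθ_def]; linarith
  set S := ∑' i, κ'⁻¹ * |c i| with hS
  have hS0 : 0 ≤ S := tsum_nonneg fun i => by positivity
  refine isLittleO_of_contraction (g := fun t => K * S * tail F (ρ * t))
    (k := fun t => A * (θ * t)⁻¹) hθ hθ1 (fun t => measureReal_nonneg)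
    (fun t => measureReal_le_one) (fun s t hst => hf.antitone (by gcongr))
    (fun t => hf.pos _) ?_ ((hf.isLittleO_of_lt (inv_pos.2 hκ0) hρ1).const_mul_left _) ?_ ?_
  · have hρt : Tendsto (fun t : ℝ => ρ * t) atTop atTop := tendsto_id.const_mul_atTop hρ0
    filter_upwards [hρt.eventually_ge_atTop s₀, eventually_gt_atTop 0] with t h1 ht
    have key := measure_lt_tsum_le P hZ
      (hind.comp (fun i x => ‖c i * x‖ₑ) fun i => (measurable_id.const_mul _).enorm)
      (ENNReal.ofReal (θ * t)) (ENNReal.ofReal (ρ * κ' * t)) (ENNReal.ofReal (θ * t))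
    rw [← ENNReal.ofReal_add (by positivity) (by positivity),
      ← ENNReal.ofReal_add (by positivity) (by positivity),
      show θ * t + ρ * κ' * t + θ * t = t by rw [hθ_def]; ring] at key
    have hsum : ∑' i, P {ω | ENNReal.ofReal (ρ * κ' * t) < ‖c i * X i ω‖ₑ} ≤
        ENNReal.ofReal (K * S * tail F (ρ * t)) := by
      have hle : ∀ i, P {ω | ENNReal.ofReal (ρ * κ' * t) < ‖c i * X i ω‖ₑ} ≤
          ENNReal.ofReal (K * (κ'⁻¹ * |c i|) * tail F (ρ * t)) := by
        intro i
        rw [(hlaw i).measure_eq (p := fun x => ENNReal.ofReal (ρ * κ' * t) < ‖c i * x‖ₑ)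
          (measurableSet_lt measurable_const (measurable_id.const_mul _).enorm)]
        have e : κ'⁻¹ * (ρ * κ' * t) = ρ * t := by field_simp
        have := hKb (c i) κ' (ρ * κ' * t) hκ' (hcκ i) (by positivity) (by rw [e]; exact h1)
        rwa [e] at this
      refine (ENNReal.tsum_le_tsum hle).trans ?_
      have hsm : Summable fun i => K * (κ'⁻¹ * |c i|) * tail F (ρ * t) :=
        ((hc.mul_left _).mul_left _).mul_right _
      rw [← ENNReal.ofReal_tsum_of_nonneg (fun i => by
        have := hf.pos (ρ * t); positivity) hsm, tsum_mul_right, tsum_mul_left]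
    have hne : P {ω | ENNReal.ofReal (θ * t) < ∑' i, ‖c i * X i ω‖ₑ} *
        P {ω | ENNReal.ofReal (θ * t) < ∑' i, ‖c i * X i ω‖ₑ} ≠ ∞ :=
      ENNReal.mul_ne_top (measure_ne_top _ _) (measure_ne_top _ _)
    have key2 := ENNReal.toReal_mono (ENNReal.add_ne_top.2 ⟨ENNReal.ofReal_ne_top, hne⟩)
      (key.trans (add_le_add_left hsum _))
    rw [ENNReal.toReal_add ENNReal.ofReal_ne_top hne, ENNReal.toReal_mul,
      ENNReal.toReal_ofReal (by have := hf.pos (ρ * t); positivity)] at key2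
    refine key2.trans (add_le_add_right ?_ _)
    exact mul_le_mul_of_nonneg_right
      (measureReal_ofReal_lt_le (measurable_tsum_ennreal hZ).aemeasurable hfin (by positivity))
      ENNReal.toReal_nonneg
  · have := (hf.slow 1 one_pos (κ⁻¹ * θ) κ⁻¹ (by positivity) (by positivity)).const_mul_left
      (A * θ⁻¹)
    refine this.congr_left fun t => ?_
    rw [Real.rpow_neg_one, mul_inv, mul_assoc κ⁻¹]
    ring
  · filter_upwards [eventually_gt_atTop 0] with t ht
    positivity

/-! ### The single big term -/

open Classical in
/-- The sum of the `|y j|` over the indices `j` outside the finite set `I`, as an extended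
nonnegative number. -/
noncomputable def restNorm {ι : Type*} (I : Finset ι) (y : ι → ℝ) : ℝ≥0∞ :=
  ∑' j, if j ∈ I then 0 else ‖y j‖ₑ

theorem sum_enorm_add_restNorm {ι : Type*} (I : Finset ι) (y : ι → ℝ) :
    ∑ i ∈ I, ‖y i‖ₑ + restNorm I y = ∑' i, ‖y i‖ₑ := by
  classical
  have h1 : ∑ i ∈ I, ‖y i‖ₑ = ∑' i, if i ∈ I then ‖y i‖ₑ else 0 := by
    rw [tsum_eq_sum (s := I) fun i hi => if_neg hi]
    exact Finset.sum_congr rfl fun i hi => (if_pos hi).symm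
  rw [restNorm, h1, ← ENNReal.tsum_add]
  refine tsum_congr fun i => ?_
  split_ifs <;> simp

theorem enorm_add_restNorm {ι : Type*} (i : ι) (y : ι → ℝ) :
    ‖y i‖ₑ + restNorm {i} y = ∑' i, ‖y i‖ₑ := by
  rw [← sum_enorm_add_restNorm {i} y, Finset.sum_singleton]

theorem enorm_le_restNorm {ι : Type*} {i j : ι} (hij : j ≠ i) (y : ι → ℝ) :
    ‖y j‖ₑ ≤ restNorm {i} y := by
  classical
  refine le_trans ?_ (ENNReal.le_tsum j)
  simp [hij]

theorem abs_tsum_sub_le {ι : Type*} (i : ι) {y : ι → ℝ} (hfin : ∑' i, ‖y i‖ₑ ≠ ∞) :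
    |∑' j, y j - y i| ≤ (restNorm {i} y).toReal := by
  classical
  have hs : Summable y := (tsum_enorm_ne_top_iff_summable_norm.1 hfin).of_norm
  have hr : restNorm {i} y ≠ ∞ := by
    rw [← enorm_add_restNorm i y] at hfin
    exact (ENNReal.add_ne_top.1 hfin).2
  rw [hs.tsum_eq_add_tsum_ite i, add_sub_cancel_left, ← Real.norm_eq_abs, ← toReal_enorm]
  refine ENNReal.toReal_mono hr (enorm_tsum_le_tsum_enorm.trans (le_of_eq ?_))
  refine tsum_congr fun j => ?_
  by_cases h : j = i <;> simp [h]

/-- If `∑ y i > t`, then some `y i` with `i ∈ I` exceeds `t`, or one of three exceptional situations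
occurs: the terms outside `I` are large, or some `y i` with `i ∈ I` is close to `t` relatively to
the other terms, or some `y i` with `i ∈ I` and the sum of the others are both large. -/
theorem one_big_term_of_lt_tsum {ι : Type*} (I : Finset ι) {y : ι → ℝ}
    (hfin : ∑' i, ‖y i‖ₑ ≠ ∞) {t η : ℝ} (ht : 0 < t) (hη : 0 < η) (hη1 : η < 1)
    (hlt : t < ∑' i, y i) :
    ((∃ i ∈ I, t < y i) ∨ ENNReal.ofReal ((1 - η) * t) < restNorm I y) ∨
      ∃ i ∈ I, (restNorm {i} y ≤ ENNReal.ofReal (η * t) ∧ t - (restNorm {i} y).toReal < y i ∧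
          y i ≤ t + (restNorm {i} y).toReal) ∨
        (ENNReal.ofReal (η * t / (I.card + 1)) < ‖y i‖ₑ ∧
          ENNReal.ofReal (η * t) < restNorm {i} y) := by
  by_contra! hcon
  obtain ⟨⟨h1, h2⟩, h3⟩ := hcon
  have hN : (0 : ℝ) < I.card + 1 := by positivity
  have hbig : ∀ i ∈ I, ENNReal.ofReal (η * t) < restNorm {i} y := by
    intro i hi
    by_contra! hle
    have hd := abs_le.1 (abs_tsum_sub_le i hfin)
    have := (h3 i hi).1 hle (by linarith [hd.2])
    linarith [h1 i hi, ENNReal.toReal_nonneg (a := restNorm {i} y)]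
  have hsmall : ∀ i ∈ I, ‖y i‖ₑ ≤ ENNReal.ofReal (η * t / (I.card + 1)) := by
    intro i hi
    by_contra! hlt'
    exact absurd (hbig i hi) (not_lt.2 ((h3 i hi).2 hlt'))
  have hsum : ∑ i ∈ I, ‖y i‖ₑ ≤ ENNReal.ofReal (η * t) := by
    refine (Finset.sum_le_card_nsmul _ _ _ hsmall).trans ?_
    rw [← ENNReal.ofReal_nsmul, nsmul_eq_mul]
    refine ENNReal.ofReal_le_ofReal ?_
    rw [mul_div_assoc', div_le_iff₀ hN]
    nlinarith [mul_pos hη ht]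
  have htot : ∑' i, ‖y i‖ₑ ≤ ENNReal.ofReal t := by
    rw [← sum_enorm_add_restNorm I y]
    refine (add_le_add hsum h2).trans (le_of_eq ?_)
    rw [← ENNReal.ofReal_add (by positivity) (mul_nonneg (by linarith) ht.le)]
    ring_nf
  have h4 := (enorm_tsum_le_tsum_enorm (f := y)).trans htot
  refine absurd h4 (not_le.2 ((ofReal_lt_enorm_iff ht.le).2 ?_))
  exact hlt.trans_le (le_abs_self _)

theorem lt_tsum_of_lt {ι : Type*} {i : ι} {y : ι → ℝ} {t b : ℝ}
    (hb : restNorm {i} y ≤ ENNReal.ofReal b) (hi : t + (restNorm {i} y).toReal < y i) :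
    t < ∑' j, y j := by
  have hfin : ∑' i, ‖y i‖ₑ ≠ ∞ := by
    rw [← enorm_add_restNorm i y]
    exact ENNReal.add_ne_top.2 ⟨enorm_ne_top, ne_top_of_le_ne_top ENNReal.ofReal_ne_top hb⟩
  have := (abs_le.1 (abs_tsum_sub_le i hfin)).1
  linarith

theorem measureReal_Ioc_eq (μ : Measure ℝ) [IsFiniteMeasure μ] {x y : ℝ} (hxy : x ≤ y) :
    μ.real (Set.Ioc x y) = tail μ x - tail μ y := by
  rw [tail, tail, ← Set.Ioi_sdiff_Ioi,
    measureReal_sdiff (Set.Ioi_subset_Ioi hxy) measurableSet_Ioi]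

/-- The probability that `U` lies within an independent `V` of the level `t`: a bound `K s` for a
window of fixed half-width `s` integrates to `K` times the mean of `V`. -/
theorem measureReal_window_le {Ω : Type*} [MeasurableSpace Ω] {P : Measure Ω}
    [IsProbabilityMeasure P] {U : Ω → ℝ} {V : Ω → ℝ≥0∞} (hU : Measurable U) (hV : Measurable V)
    (hind : IndepFun V U P) (hfin : ∫⁻ ω, V ω ∂P < ∞) {t b K : ℝ} (hK : 0 ≤ K) (hb : 0 ≤ b)
    (hwin : ∀ s, 0 ≤ s → s ≤ b → tail (P.map U) (t - s) - tail (P.map U) (t + s) ≤ K * s) :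
    P.real {ω | V ω ≤ ENNReal.ofReal b ∧ t - (V ω).toReal < U ω ∧ U ω ≤ t + (V ω).toReal} ≤
      K * (∫⁻ ω, V ω ∂P).toReal := by
  have : IsProbabilityMeasure (P.map U) := Measure.isProbabilityMeasure_map hU.aemeasurable
  set E : Set (ℝ≥0∞ × ℝ) :=
    {p | p.1 ≤ ENNReal.ofReal b ∧ t - p.1.toReal < p.2 ∧ p.2 ≤ t + p.1.toReal} with hE
  have hEm : MeasurableSet E := by
    refine (measurableSet_le measurable_fst measurable_const).inter
      ((measurableSet_lt (by fun_prop) measurable_snd).inter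
        (measurableSet_le measurable_snd (by fun_prop)))
  have h1 : P {ω | V ω ≤ ENNReal.ofReal b ∧ t - (V ω).toReal < U ω ∧
      U ω ≤ t + (V ω).toReal} ≤ ENNReal.ofReal K * ∫⁻ ω, V ω ∂P := by
    calc P {ω | V ω ≤ ENNReal.ofReal b ∧ t - (V ω).toReal < U ω ∧ U ω ≤ t + (V ω).toReal}
        = P.map (fun ω => (V ω, U ω)) E := by
          rw [Measure.map_apply (hV.prodMk hU) hEm]; rfl
      _ = ∫⁻ v, P.map U (Prod.mk v ⁻¹' E) ∂(P.map V) := by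
          rw [(indepFun_iff_map_prod_eq_prod_map_map hV.aemeasurable hU.aemeasurable).1 hind,
            Measure.prod_apply hEm]
      _ ≤ ∫⁻ v, ENNReal.ofReal K * v ∂(P.map V) := by
          refine lintegral_mono fun v => ?_
          by_cases hv : v ≤ ENNReal.ofReal b
          · have hvt : v ≠ ∞ := ne_top_of_le_ne_top ENNReal.ofReal_ne_top hv
            have e : Prod.mk v ⁻¹' E = Set.Ioc (t - v.toReal) (t + v.toReal) := by
              ext x
              exact ⟨fun h => h.2, fun h => ⟨hv, h⟩⟩
            have hv0 : 0 ≤ v.toReal := ENNReal.toReal_nonneg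
            rw [e, ← ENNReal.ofReal_toReal (measure_ne_top (P.map U) (Set.Ioc _ _)),
              ← ENNReal.ofReal_toReal hvt, ENNReal.toReal_ofReal hv0, ← ENNReal.ofReal_mul hK]
            refine ENNReal.ofReal_le_ofReal ?_
            have := measureReal_Ioc_eq (P.map U) (x := t - v.toReal) (y := t + v.toReal)
              (by linarith)
            rw [Measure.real] at this
            rw [this]
            exact hwin _ hv0 (ENNReal.toReal_le_of_le_ofReal hb hv)
          · have e : Prod.mk v ⁻¹' E = ∅ := by
              ext x
              exact ⟨fun h => hv h.1, fun h => h.elim⟩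
            simp [e]
      _ = ENNReal.ofReal K * ∫⁻ ω, V ω ∂P := by
          rw [lintegral_const_mul' _ _ ENNReal.ofReal_ne_top, lintegral_map measurable_id' hV]
  have h2 := ENNReal.toReal_mono (ENNReal.mul_lt_top ENNReal.ofReal_lt_top hfin).ne h1
  rwa [ENNReal.toReal_mul, ENNReal.toReal_ofReal hK] at h2

theorem tail_mulDist_eq {Ω : Type*} [MeasurableSpace Ω] {P : Measure Ω} {F : Measure ℝ}
    {X : Ω → ℝ} (hX : HasLaw X F P) (c t : ℝ) :
    tail (mulDist c F) t = P.real {ω | t < c * X ω} := by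
  rw [tail, mulDist, map_measureReal_apply (measurable_const_mul c) measurableSet_Ioi,
    Measure.real, Measure.real, hX.measure_eq (p := fun x => t < c * x)
      (measurableSet_lt measurable_const (measurable_id.const_mul c))]
  rfl

/-- The tail of the series is the sum of the tails of the terms with weights at least `κ` in
absolute value, up to a negligible quantity. The hypothesis `hwin` bounds the probability that
`c X` lies within `s` of `t`. -/
theorem isLittleO_tail_tsum {Ω : Type*} [MeasurableSpace Ω] {P : Measure Ω}
    [IsProbabilityMeasure P] {F : Measure ℝ} [IsProbabilityMeasure F]
    (hf : ModerateTail (tail F))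
    (habs : (fun t => F.real {x | t < |x|}) =O[atTop] tail F)
    (hwin : ∀ c : ℝ, c ≠ 0 → ∃ a C : ℝ, 0 < a ∧ 0 < C ∧ ∀ᶠ t in atTop, ∀ s, 0 ≤ s → s ≤ t / 2 →
      tail (mulDist c F) (t - s) - tail (mulDist c F) (t + s) ≤
        C * (t ^ (-(3 / 4) : ℝ) * tail F (a * t)) * s)
    {ι : Type*} [Denumerable ι] {X : ι → Ω → ℝ} (hX : ∀ i, Measurable (X i))
    (hlaw : ∀ i, HasLaw (X i) F P) (hind : iIndepFun X P)
    {c : ι → ℝ} (hc : Summable fun i => |c i|) {κ : ℝ} (hκ : 0 < κ) (I : Finset ι)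
    (hI : ∀ i, i ∈ I ↔ κ ≤ |c i|) :
    (fun t : ℝ => P.real {ω | t < ∑' i, c i * X i ω} - ∑ i ∈ I, tail (mulDist (c i) F) t)
      =o[atTop] fun t => tail F (κ⁻¹ * t) := by
  classical
  have hfin := lintegral_tsum_enorm_lt_top hf habs hlaw hc
  -- the weights below the threshold `κ` stay below some `κ' < κ`
  obtain ⟨κ', hκ'0, hκ'κ, hκ'⟩ : ∃ κ', 0 < κ' ∧ κ' < κ ∧ ∀ i, i ∉ I → |c i| ≤ κ' := by
    have hJ : {i | κ / 2 < |c i|}.Finite := by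
      have := hc.tendsto_cofinite_zero.eventually_le_const (half_pos hκ)
      simpa [Filter.eventually_cofinite] using this
    have h1 : ∀ᶠ κ' in 𝓝[<] κ, ∀ i ∈ {i | κ / 2 < |c i|}, i ∉ I → |c i| ≤ κ' := by
      rw [hJ.eventually_all]
      intro i _
      by_cases hi : i ∈ I
      · exact Eventually.of_forall fun _ h => absurd hi h
      · have : |c i| < κ := not_le.1 fun h => hi ((hI i).2 h)
        filter_upwards [Ioo_mem_nhdsLT this] with x hx _ using hx.1.le
    obtain ⟨κ', h2, h3⟩ := (h1.and (Ioo_mem_nhdsLT (half_lt_self hκ))).exists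
    refine ⟨κ', (half_pos hκ).trans h3.1, h3.2, fun i hi => ?_⟩
    rcases lt_or_ge (κ / 2) |c i| with h | h
    · exact h2 i h hi
    · exact h.trans h3.1.le
  -- the small terms remain negligible at the level `(1 - η) t`
  obtain ⟨η, hη0, hη2, hηκ⟩ : ∃ η : ℝ, 0 < η ∧ η ≤ 1 / 2 ∧ κ' < (1 - η) * κ := by
    obtain ⟨x, h1, h2⟩ := exists_between hκ'κ
    refine ⟨min (1 / 2) (1 - x / κ), ?_, min_le_left _ _, ?_⟩
    · exact lt_min (by norm_num) (by rw [sub_pos, div_lt_one hκ]; exact h2)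
    · have := min_le_right (1 / 2) (1 - x / κ)
      calc κ' < x := h1
        _ = (1 - (1 - x / κ)) * κ := by field_simp; ring
        _ ≤ _ := by gcongr
  have hη1 : η < 1 := by linarith
  set Y : Ω → ι → ℝ := fun ω i => c i * X i ω with hY
  set N : ℝ := I.card + 1 with hN
  have hN0 : 0 < N := by positivity
  -- the exceptional events: `c i X i` is close to `t`, two terms are large, the small terms
  -- are large
  set W : ι → ℝ → Set Ω := fun i t => {ω | restNorm {i} (Y ω) ≤ ENNReal.ofReal (η * t) ∧
    t - (restNorm {i} (Y ω)).toReal < c i * X i ω ∧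
      c i * X i ω ≤ t + (restNorm {i} (Y ω)).toReal} with hW
  set D : ι → ℝ → Set Ω := fun i t => {ω | ENNReal.ofReal (η * t / N) < ‖c i * X i ω‖ₑ ∧
    ENNReal.ofReal (η * t) < restNorm {i} (Y ω)} with hD
  set R : ℝ → Set Ω := fun t => {ω | ENNReal.ofReal ((1 - η) * t) < restNorm I (Y ω)} with hR
  have hrestm : ∀ J : Finset ι, Measurable fun ω => restNorm J (Y ω) := fun J =>
    measurable_tsum_ennreal fun j => by
      split_ifs
      · exact measurable_const
      · exact ((hX j).const_mul _).enorm
  have hrestfin : ∀ i, ∫⁻ ω, restNorm {i} (Y ω) ∂P < ∞ := fun i =>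
    lt_of_le_of_lt (lintegral_mono fun ω => by
      rw [← enorm_add_restNorm i (Y ω)]; exact le_add_self) hfin
  have hrestind : ∀ i, IndepFun (fun ω => restNorm {i} (Y ω)) (X i) P := fun i => by
    refine indepFun_of_disjoint hX hind (S := {i}ᶜ) (T := {i}) disjoint_compl_left
      (measurable_tsum_ennreal fun j => ?_) (measurable_of_mem_iSup_comap (Set.mem_singleton i))
    by_cases hj : j ∈ ({i} : Finset ι)
    · simp only [hj, if_true]
      exact measurable_const
    · simp only [hj, if_false]
      exact (show Measurable fun x : ℝ => ‖c j * x‖ₑ from (measurable_const_mul _).enorm).comp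
        (measurable_of_mem_iSup_comap (by simpa using hj))
  have hR_o : (fun t => P.real (R t)) =o[atTop] fun t => tail F (κ⁻¹ * t) := by
    have hc' : Summable fun i => |if i ∈ I then 0 else c i| := by
      refine hc.of_nonneg_of_le (fun i => abs_nonneg _) fun i => ?_
      split_ifs <;> simp
    have h1 := isLittleO_measureReal_tsum_enorm hf habs hX hlaw hind hc' hκ'0 hηκ fun i => by
      split_ifs with hi
      · simpa using hκ'0.le
      · exact hκ' i hi
    have h2 : Tendsto (fun t : ℝ => (1 - η) * t) atTop atTop :=
      tendsto_id.const_mul_atTop (by linarith)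
    refine (h1.comp_tendsto h2).congr (fun t => ?_) fun t => ?_
    · have e : ∀ i ω, ‖(if i ∈ I then 0 else c i) * X i ω‖ₑ = if i ∈ I then 0 else ‖Y ω i‖ₑ :=
        fun i ω => by split_ifs <;> simp [hY]
      simp only [Function.comp, hR, restNorm, e]
    · simp only [Function.comp]
      congr 1
      have : 1 - η ≠ 0 := by linarith
      field_simp
  have hW_o : ∀ i ∈ I, (fun t => P.real (W i t)) =o[atTop] fun t => tail F (κ⁻¹ * t) := by
    intro i hi
    have hci : c i ≠ 0 := abs_pos.1 (hκ.trans_le ((hI i).1 hi))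
    obtain ⟨a, C, ha, hC, haC⟩ := hwin (c i) hci
    refine IsBigO.trans_isLittleO (IsBigO.of_bound
      (C * (∫⁻ ω, restNorm {i} (Y ω) ∂P).toReal) ?_)
      (hf.slow (3 / 4) (by norm_num) a κ⁻¹ ha (by positivity))
    filter_upwards [haC, eventually_gt_atTop 0] with t h1 ht
    have hp := hf.pos (a * t)
    rw [Real.norm_of_nonneg measureReal_nonneg, Real.norm_of_nonneg (by positivity)]
    have emap : P.map (fun ω => c i * X i ω) = mulDist (c i) F := by
      rw [mulDist, ← (hlaw i).map_eq, Measure.map_map (measurable_const_mul _) (hX i)]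
      rfl
    have := measureReal_window_le (U := fun ω => c i * X i ω) ((hX i).const_mul _) (hrestm {i})
      ((hrestind i).comp measurable_id (measurable_id.const_mul (c i))) (hrestfin i) (t := t)
      (b := η * t) (K := C * (t ^ (-(3 / 4) : ℝ) * tail F (a * t))) (by positivity)
      (by positivity) (by
        intro s h2 h3
        rw [emap]
        exact h1 s h2 (by nlinarith))
    refine this.trans (le_of_eq ?_)
    ring
  have hD_o : ∀ i ∈ I, (fun t => P.real (D i t)) =o[atTop] fun t => tail F (κ⁻¹ * t) := by
    intro i hi
    have hci : 0 < |c i| := hκ.trans_le ((hI i).1 hi)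
    obtain ⟨K, s₀, hK, hKb⟩ := exists_measure_enorm_mul_le hf habs
    set M := (∫⁻ ω, restNorm {i} (Y ω) ∂P).toReal
    set a := |c i|⁻¹ * (η / N)
    have ha : 0 < a := by positivity
    refine IsBigO.trans_isLittleO (IsBigO.of_bound (K * M * η⁻¹) ?_)
      (hf.slow 1 one_pos a κ⁻¹ ha (by positivity))
    have hat : Tendsto (fun t : ℝ => a * t) atTop atTop := tendsto_id.const_mul_atTop ha
    filter_upwards [hat.eventually_ge_atTop s₀, eventually_gt_atTop 0] with t h1 ht
    have hp := hf.pos (a * t)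
    rw [Real.norm_of_nonneg measureReal_nonneg, Real.norm_of_nonneg (by positivity)]
    have e : |c i|⁻¹ * (η * t / N) = a * t := by simp only [a]; ring
    have b1 := hKb (c i) |c i| (η * t / N) hci le_rfl (by positivity) (by rw [e]; exact h1)
    rw [e, inv_mul_cancel₀ hci.ne', mul_one, ← (hlaw i).measure_eq
      (p := fun x => ENNReal.ofReal (η * t / N) < ‖c i * x‖ₑ)
      (measurableSet_lt measurable_const (measurable_id.const_mul _).enorm)] at b1
    have b2 : P.real {ω | ENNReal.ofReal (η * t / N) < ‖c i * X i ω‖ₑ} ≤ K * tail F (a * t) :=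
      ENNReal.toReal_le_of_le_ofReal (by positivity) b1
    have b3 := measureReal_ofReal_lt_le (hrestm {i}).aemeasurable (hrestfin i)
      (t := η * t) (by positivity)
    have hprod : P.real (D i t) = P.real {ω | ENNReal.ofReal (η * t / N) < ‖c i * X i ω‖ₑ} *
        P.real {ω | ENNReal.ofReal (η * t) < restNorm {i} (Y ω)} := by
      have := ((hrestind i).symm.comp ((measurable_id.const_mul (c i)).enorm)
        measurable_id).measure_inter_preimage_eq_mul (Set.Ioi (ENNReal.ofReal (η * t / N)))
          (Set.Ioi (ENNReal.ofReal (η * t))) measurableSet_Ioi measurableSet_Ioi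
      rw [Measure.real, Measure.real, Measure.real, ← ENNReal.toReal_mul]
      exact congrArg ENNReal.toReal this
    rw [hprod]
    refine (mul_le_mul b2 b3 measureReal_nonneg (by positivity)).trans (le_of_eq ?_)
    rw [Real.rpow_neg_one, mul_inv]
    ring
  have hdom : (fun t => ∑ i ∈ I, (P.real (W i t) + P.real (D i t)) + P.real (R t)) =o[atTop]
      fun t => tail F (κ⁻¹ * t) :=
    (IsLittleO.fun_sum fun i hi => (hW_o i hi).add (hD_o i hi)).add hR_o
  refine IsBigO.trans_isLittleO (IsBigO.of_bound 1 ?_) hdom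
  filter_upwards [eventually_gt_atTop 0] with t ht
  have hsum0 : 0 ≤ ∑ i ∈ I, (P.real (W i t) + P.real (D i t)) + P.real (R t) :=
    add_nonneg (Finset.sum_nonneg fun i _ => add_nonneg measureReal_nonneg measureReal_nonneg)
      measureReal_nonneg
  rw [Real.norm_of_nonneg hsum0, Real.norm_eq_abs, one_mul]
  simp only [fun i => tail_mulDist_eq (hlaw i) (c i) t]
  rw [abs_le]
  constructor
  -- lower bound: the events `E i` are disjoint and contained in the event that the series
  -- exceeds `t`
  · set E : ι → Set Ω := fun i => {ω | restNorm {i} (Y ω) ≤ ENNReal.ofReal (η * t) ∧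
      t + (restNorm {i} (Y ω)).toReal < c i * X i ω}
    have hEm : ∀ i, MeasurableSet (E i) := fun i =>
      (measurableSet_le (hrestm {i}) measurable_const).inter
        (measurableSet_lt ((hrestm {i}).ennreal_toReal.const_add t) ((hX i).const_mul _))
    have hdisj : Set.PairwiseDisjoint (I : Set ι) E := by
      intro i _ j _ hij
      rw [Function.onFun, Set.disjoint_left]
      intro ω h1 h2
      have h3 : ENNReal.ofReal (η * t) < ‖Y ω j‖ₑ := by
        rw [ofReal_lt_enorm_iff (by positivity)]
        have h4 : t + (restNorm {j} (Y ω)).toReal < Y ω j := h2.2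
        have := ENNReal.toReal_nonneg (a := restNorm {j} (Y ω))
        have := le_abs_self (Y ω j)
        nlinarith
      exact absurd ((enorm_le_restNorm hij.symm (Y ω)).trans h1.1) (not_le.2 h3)
    have h1 : ∑ i ∈ I, P.real (E i) ≤ P.real {ω | t < ∑' i, c i * X i ω} := by
      rw [← measureReal_biUnion_finset hdisj fun i _ => hEm i]
      refine measureReal_mono (Set.iUnion₂_subset fun i _ ω hω => ?_)
      exact lt_tsum_of_lt (y := Y ω) hω.1 hω.2
    have h2 : ∀ i ∈ I, P.real {ω | t < c i * X i ω} ≤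
        P.real (E i) + (P.real (W i t) + P.real (D i t)) := by
      intro i _
      refine le_trans (measureReal_mono (s₂ := E i ∪ (W i t ∪ D i t)) fun ω hω => ?_)
        ((measureReal_union_le _ _).trans (add_le_add_right (measureReal_union_le _ _) _))
      have hω' : t < c i * X i ω := hω
      have hr0 := ENNReal.toReal_nonneg (a := restNorm {i} (Y ω))
      rcases le_or_gt (restNorm {i} (Y ω)) (ENNReal.ofReal (η * t)) with h | h
      · rcases lt_or_ge (t + (restNorm {i} (Y ω)).toReal) (c i * X i ω) with h' | h'
        · exact Or.inl ⟨h, h'⟩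
        · exact Or.inr (Or.inl ⟨h, by linarith, h'⟩)
      · refine Or.inr (Or.inr ⟨?_, h⟩)
        rw [ofReal_lt_enorm_iff (by positivity)]
        refine lt_of_le_of_lt ?_ (hω'.trans_le (le_abs_self _))
        rw [div_le_iff₀ hN0]
        have : (1 : ℝ) ≤ N := by simp [hN]
        nlinarith
    have h3 := Finset.sum_le_sum h2
    rw [Finset.sum_add_distrib] at h3
    have : 0 ≤ P.real (R t) := measureReal_nonneg
    linarith
  -- upper bound: the series does not exceed `t` outside the exceptional events and the null set `Z`
  -- where it does not converge absolutely, unless a single term does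
  · set Z : Set Ω := {ω | ∑' i, ‖c i * X i ω‖ₑ = ∞}
    have hZ0 : P.real Z = 0 := by
      have : ∀ᵐ ω ∂P, ∑' i, ‖c i * X i ω‖ₑ < ∞ :=
        ae_lt_top (measurable_tsum_ennreal fun i => ((hX i).const_mul _).enorm) hfin.ne
      rw [Measure.real, ENNReal.toReal_eq_zero_iff]
      left
      refine measure_mono_null (fun ω hω => ?_) (ae_iff.1 this)
      exact not_lt.2 (ge_of_eq hω)
    have hcov : {ω | t < ∑' i, c i * X i ω} ⊆
        ((⋃ i ∈ I, {ω | t < c i * X i ω}) ∪ ⋃ i ∈ I, (W i t ∪ D i t)) ∪ (R t ∪ Z) := by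
      intro ω hω
      by_cases hz : ∑' i, ‖c i * X i ω‖ₑ = ∞
      · exact Or.inr (Or.inr hz)
      rcases one_big_term_of_lt_tsum I (y := Y ω) hz ht hη0 hη1 hω with
        (⟨i, hi, h⟩ | h) | ⟨i, hi, h⟩
      · exact Or.inl (Or.inl (Set.mem_biUnion hi h))
      · exact Or.inr (Or.inl h)
      · exact Or.inl (Or.inr (Set.mem_biUnion hi h))
    have h1 := measureReal_mono hcov (μ := P)
    have h2 := measureReal_union_le (μ := P)
      ((⋃ i ∈ I, {ω | t < c i * X i ω}) ∪ ⋃ i ∈ I, (W i t ∪ D i t)) (R t ∪ Z)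
    have h3 := measureReal_union_le (μ := P)
      (⋃ i ∈ I, {ω | t < c i * X i ω}) (⋃ i ∈ I, (W i t ∪ D i t))
    have h4 := measureReal_union_le (μ := P) (R t) Z
    have h5 := measureReal_biUnion_finset_le (μ := P) I fun i => {ω | t < c i * X i ω}
    have h6 : P.real (⋃ i ∈ I, (W i t ∪ D i t)) ≤ ∑ i ∈ I, (P.real (W i t) + P.real (D i t)) :=
      (measureReal_biUnion_finset_le (μ := P) I fun i => W i t ∪ D i t).trans
        (Finset.sum_le_sum fun i _ => measureReal_union_le _ _)
    linarith

/-! ### The order on the weights and the tail of the series -/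

theorem mulDist_mulDist (a b : ℝ) (F : Measure ℝ) :
    mulDist a (mulDist b F) = mulDist (a * b) F := by
  rw [mulDist, mulDist, mulDist, Measure.map_map (measurable_const_mul a) (measurable_const_mul b)]
  congr 1
  ext x
  simp [mul_assoc]

theorem tail_mulDist_of_pos (F : Measure ℝ) {c : ℝ} (hc : 0 < c) (t : ℝ) :
    tail (mulDist c F) t = tail F (c⁻¹ * t) := by
  rw [tail, tail, mulDist, map_measureReal_apply (measurable_const_mul c) measurableSet_Ioi]
  congr 1
  ext x
  simp only [Set.mem_preimage, Set.mem_Ioi]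
  rw [inv_mul_lt_iff₀ hc]

theorem tail_mulDist_of_neg (F : Measure ℝ) {c : ℝ} (hc : c < 0) (t : ℝ) :
    tail (mulDist c F) t = tail (mulDist (-1) F) (|c|⁻¹ * t) := by
  rw [← tail_mulDist_of_pos _ (abs_pos.2 hc.ne), mulDist_mulDist, abs_of_neg hc]
  simp

instance isProbabilityMeasure_mulDist (c : ℝ) (F : Measure ℝ) [IsProbabilityMeasure F] :
    IsProbabilityMeasure (mulDist c F) :=
  Measure.isProbabilityMeasure_map (measurable_const_mul c).aemeasurable

theorem tail_mulDist_zero (F : Measure ℝ) : ∀ᶠ t in atTop, tail (mulDist 0 F) t = 0 := by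
  filter_upwards [eventually_ge_atTop 0] with t ht
  rw [tail, mulDist, map_measureReal_apply (measurable_const_mul 0) measurableSet_Ioi]
  have : (fun x : ℝ => 0 * x) ⁻¹' Set.Ioi t = ∅ := by
    ext x
    simp [ht]
  rw [this, measureReal_empty]

theorem tail_mulDist_of_neg_of_bddBelow {F : Measure ℝ} {A : ℝ} (hA : F (Set.Iic A) = 0) {c : ℝ}
    (hc : c < 0) : ∀ᶠ t in atTop, tail (mulDist c F) t = 0 := by
  filter_upwards [eventually_ge_atTop (c * A)] with t ht
  rw [tail, mulDist, map_measureReal_apply (measurable_const_mul c) measurableSet_Ioi,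
    Measure.real, ENNReal.toReal_eq_zero_iff]
  left
  refine measure_mono_null (fun x hx => ?_) hA
  have hx' : t < c * x := hx
  have : x < A := lt_of_mul_lt_mul_of_nonpos_left (ht.trans_lt hx') hc.le
  exact this.le

theorem TailBalanced.isTheta {F : Measure ℝ} (h : TailBalanced F) :
    tail (mulDist (-1) F) =Θ[atTop] tail F := by
  obtain ⟨L, hL, hlim⟩ := h
  exact isTheta_of_div_tendsto_nhds_ne_zero hlim hL.ne'

/-- The displacement bound for `g`, written in terms of a tail `f` of larger order, for windows
around `t` of half-width up to `t / 2`. -/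
theorem exists_window_bound {f g : ℝ → ℝ} (hf : ModerateTail f) (hg : ModerateTail g)
    (hgf : g =O[atTop] f) {b : ℝ} (hb : 0 < b) :
    ∃ a C : ℝ, 0 < a ∧ 0 < C ∧ ∀ᶠ t in atTop, ∀ s, 0 ≤ s → s ≤ t / 2 →
      g (b * (t - s)) - g (b * (t + s)) ≤ C * (t ^ (-(3 / 4) : ℝ) * f (a * t)) * s := by
  obtain ⟨K, hK, hKb⟩ := hgf.exists_pos
  obtain ⟨x₀, hx₀⟩ := eventually_atTop.1 (hg.smooth.and hKb.bound)
  set a := b / 2 with ha_def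
  have ha : 0 < a := half_pos hb
  refine ⟨a, K * (2 * b * a ^ (-(3 / 4) : ℝ)), ha, by positivity, ?_⟩
  have hat : Tendsto (fun t : ℝ => a * t) atTop atTop := tendsto_id.const_mul_atTop ha
  filter_upwards [hat.eventually_ge_atTop x₀, eventually_gt_atTop 0] with t h1 ht s hs0 hs
  have hle : a * t ≤ b * (t - s) := by rw [ha_def]; nlinarith
  have h2 := (hx₀ _ (h1.trans hle)).1 (b * (t + s)) (by gcongr; linarith)
  have h3 := (hx₀ _ h1).2
  rw [Real.norm_of_nonneg (hg.pos _).le, Real.norm_of_nonneg (hf.pos _).le] at h3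
  have hpos := hf.pos (a * t)
  have hr : (b * (t - s)) ^ (-(3 / 4) : ℝ) ≤ (a * t) ^ (-(3 / 4) : ℝ) :=
    Real.rpow_le_rpow_of_nonpos (by positivity) hle (by norm_num)
  calc g (b * (t - s)) - g (b * (t + s))
      ≤ g (b * (t - s)) * ((b * (t + s) - b * (t - s)) * (b * (t - s)) ^ (-(3 / 4) : ℝ)) := h2
    _ ≤ (K * f (a * t)) * ((2 * b * s) * (a * t) ^ (-(3 / 4) : ℝ)) := by
        have e : b * (t + s) - b * (t - s) = 2 * b * s := by ring
        rw [e]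
        have := (hg.antitone hle).trans h3
        have hbt : 0 ≤ b * (t - s) := (mul_pos ha ht).le.trans hle
        gcongr
    _ = _ := by
        rw [Real.mul_rpow ha.le ht.le]
        ring

/-- The weight `a` is nonzero and the tail of `M_a F` has the exact order of `f (t / |a|)`. For a
negative weight this says that the lower tail of `F` is of the same order as the upper one. -/
def TailRelevant (F : Measure ℝ) (a : ℝ) : Prop :=
  a ≠ 0 ∧ tail (mulDist a F) =Θ[atTop] fun t => tail F (|a|⁻¹ * t)

/-- A weight is relevant unless the tail it gives rise to vanishes ultimately. -/
theorem eventually_zero_or_relevant {F : Measure ℝ}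
    (hlow : (∃ A : ℝ, F (Set.Iic A) = 0) ∨ TailBalanced F) (a : ℝ) :
    (∀ᶠ t in atTop, tail (mulDist a F) t = 0) ∨ TailRelevant F a := by
  rcases lt_trichotomy a 0 with ha | rfl | ha
  · rcases hlow with ⟨A, hA⟩ | hb
    · exact Or.inl (tail_mulDist_of_neg_of_bddBelow hA ha)
    · refine Or.inr ⟨ha.ne, ?_⟩
      have hat : Tendsto (fun t : ℝ => |a|⁻¹ * t) atTop atTop :=
        tendsto_id.const_mul_atTop (inv_pos.2 (abs_pos.2 ha.ne))
      have := hb.isTheta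
      have h2 : (fun t => tail (mulDist (-1) F) (|a|⁻¹ * t)) =Θ[atTop]
          fun t => tail F (|a|⁻¹ * t) := ⟨this.1.comp_tendsto hat, this.2.comp_tendsto hat⟩
      rwa [← funext fun t => tail_mulDist_of_neg F ha t] at h2
  · exact Or.inl (tail_mulDist_zero F)
  · refine Or.inr ⟨ha.ne', ?_⟩
    rw [funext fun t => tail_mulDist_of_pos F ha t, abs_of_pos ha]

/-- Above a relevant weight, the order of the tails is the order of the absolute values. -/
theorem preceq_iff {F : Measure ℝ} [IsProbabilityMeasure F] (hf : ModerateTail (tail F))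
    (hlow : (∃ A : ℝ, F (Set.Iic A) = 0) ∨ TailBalanced F) {d a : ℝ} (hd : TailRelevant F d) :
    Preceq F d a ↔ TailRelevant F a ∧ |d| ≤ |a| := by
  have hd0 := abs_pos.2 hd.1
  constructor
  · intro h
    have hO : tail (mulDist d F) =O[atTop] tail (mulDist a F) := by
      rcases h with h | ⟨ε, hε, h⟩
      · exact IsLittleO.isBigO h
      · refine IsBigO.of_bound ε⁻¹ ?_
        filter_upwards [h] with t ht
        have n1 : 0 ≤ tail (mulDist a F) t := measureReal_nonneg
        have n2 : 0 ≤ tail (mulDist d F) t := measureReal_nonneg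
        rw [Real.norm_of_nonneg n1, Real.norm_of_nonneg n2, le_inv_mul_iff₀ hε]
        exact ht.1
    have hO' : (fun t => tail F (|d|⁻¹ * t)) =O[atTop] tail (mulDist a F) :=
      hd.2.2.trans hO
    rcases eventually_zero_or_relevant hlow a with hz | hr
    · exfalso
      obtain ⟨C, hC⟩ := hO'.bound
      obtain ⟨t, h1, h2⟩ := (hC.and hz).exists
      rw [h2, norm_zero, mul_zero, Real.norm_of_nonneg (hf.pos _).le] at h1
      exact absurd (hf.pos _) (not_lt.2 h1)
    · refine ⟨hr, ?_⟩
      by_contra! hlt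
      have ha0 := abs_pos.2 hr.1
      have h1 := hf.isLittleO_of_lt (inv_pos.2 hd0) (inv_strictAnti₀ ha0 hlt)
      have h2 := (hO'.trans hr.2.1).trans_isLittleO h1
      exact (isLittleO_irrefl (Frequently.of_forall fun t => (hf.pos _).ne')) h2
  · rintro ⟨hr, hle⟩
    rcases hle.lt_or_eq with hlt | heq
    · left
      exact (hd.2.1.trans_isLittleO (hf.isLittleO_of_lt
        (inv_pos.2 (abs_pos.2 hr.1)) (inv_strictAnti₀ hd0 hlt))).trans_isBigO hr.2.2
    · right
      have hth : tail (mulDist a F) =Θ[atTop] tail (mulDist d F) := by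
        refine hr.2.trans ?_
        rw [← heq]
        exact hd.2.symm
      obtain ⟨C₁, hC₁, h1⟩ := hth.1.exists_pos
      obtain ⟨C₂, hC₂, h2⟩ := hth.2.exists_pos
      set C := max C₁ C₂
      have hC : 0 < C := hC₁.trans_le (le_max_left _ _)
      refine ⟨C⁻¹, inv_pos.2 hC, ?_⟩
      filter_upwards [h1.bound, h2.bound] with t ht1 ht2
      have n1 : 0 ≤ tail (mulDist a F) t := measureReal_nonneg
      have n2 : 0 ≤ tail (mulDist d F) t := measureReal_nonneg
      rw [Real.norm_of_nonneg n1, Real.norm_of_nonneg n2] at ht1 ht2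
      rw [inv_inv, inv_mul_le_iff₀ hC]
      exact ⟨ht2.trans (by gcongr; exact le_max_right _ _),
        ht1.trans (by gcongr; exact le_max_left _ _)⟩

theorem isBigO_measureReal_lt_abs {F : Measure ℝ} [IsProbabilityMeasure F]
    (h : tail (mulDist (-1) F) =O[atTop] tail F) :
    (fun t => F.real {x | t < |x|}) =O[atTop] tail F := by
  refine IsBigO.trans (IsBigO.of_bound 1 ?_) ((isBigO_refl (tail F) atTop).add h)
  refine Eventually.of_forall fun t => ?_
  have n1 : 0 ≤ tail F t := measureReal_nonneg
  have n2 : 0 ≤ tail (mulDist (-1) F) t := measureReal_nonneg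
  rw [Real.norm_of_nonneg measureReal_nonneg, Real.norm_of_nonneg (add_nonneg n1 n2), one_mul]
  rw [tail, tail, mulDist, map_measureReal_apply (measurable_const_mul _) measurableSet_Ioi]
  refine le_trans (measureReal_mono fun x (hx : t < |x|) => ?_) (measureReal_union_le _ _)
  rcases lt_abs.1 hx with h | h
  · exact Or.inl h
  · exact Or.inr (show t < -1 * x by linarith)

/-- The conclusion of `isLittleO_tail_tsum` for variables which are only almost everywhere
measurable. -/
theorem isLittleO_tail_series {Ω : Type*} [MeasurableSpace Ω] {P : Measure Ω}
    [IsProbabilityMeasure P] {F : Measure ℝ} [IsProbabilityMeasure F]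
    (hf : ModerateTail (tail F))
    (habs : (fun t => F.real {x | t < |x|}) =O[atTop] tail F)
    (hwin : ∀ c : ℝ, c ≠ 0 → ∃ a C : ℝ, 0 < a ∧ 0 < C ∧ ∀ᶠ t in atTop, ∀ s, 0 ≤ s → s ≤ t / 2 →
      tail (mulDist c F) (t - s) - tail (mulDist c F) (t + s) ≤
        C * (t ^ (-(3 / 4) : ℝ) * tail F (a * t)) * s)
    {ι : Type*} [Denumerable ι] {X : ι → Ω → ℝ}
    (hlaw : ∀ i, HasLaw (X i) F P) (hind : iIndepFun X P)
    {c : ι → ℝ} (hc : Summable fun i => |c i|) {κ : ℝ} (hκ : 0 < κ) (I : Finset ι)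
    (hI : ∀ i, i ∈ I ↔ κ ≤ |c i|) :
    (fun t : ℝ => P.real {ω | t < ∑' i, c i * X i ω} - ∑ i ∈ I, tail (mulDist (c i) F) t)
      =o[atTop] fun t => tail F (κ⁻¹ * t) := by
  have hae : ∀ i, X i =ᵐ[P] (hlaw i).aemeasurable.mk (X i) := fun i =>
    (hlaw i).aemeasurable.ae_eq_mk
  refine (isLittleO_tail_tsum hf habs hwin (X := fun i => (hlaw i).aemeasurable.mk (X i))
    (fun i => (hlaw i).aemeasurable.measurable_mk) (fun i => (hlaw i).congr (hae i).symm)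
    (hind.congr hae) hc hκ I hI).congr_left fun t => ?_
  congr 1
  refine measureReal_congr ?_
  filter_upwards [ae_all_iff.2 hae] with ω hω
  change (t < ∑' i, c i * (hlaw i).aemeasurable.mk (X i) ω) = (t < ∑' i, c i * X i ω)
  simp only [hω]

end LightTail

theorem theorem2p3p2 {Ω : Type*} [MeasurableSpace Ω] (P : Measure Ω) [IsProbabilityMeasure P]
    (F : Measure ℝ) [IsProbabilityMeasure F] (X : ℤ → Ω → ℝ) (c : ℤ → ℝ) (h : ℝ → ℝ)
    (hlaw : ∀ i, HasLaw (X i) F P) (hindep : iIndepFun X P)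
    (hstd : LightTail.StandardConditions F c)
    (hrate : LightTail.IsHazardRate F h) (hcond : LightTail.HazardConditions h) :
    (∀ᵐ ω ∂P, Summable fun i => c i * X i ω) ∧
    ∀ d : ℕ → ℝ, LightTail.IsDecreasingRearrangement F c d →
      ∀ m : ℕ, 1 ≤ m → d m ≠ 0 →
        {i : ℤ | LightTail.Preceq F (d m) (c i)}.Finite ∧
        (fun t : ℝ => P.real {ω | t < ∑' i, c i * X i ω}
            - ∑ᶠ i ∈ {i : ℤ | LightTail.Preceq F (d m) (c i)},
                LightTail.tail (LightTail.mulDist (c i) F) t)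
          =o[atTop] LightTail.tail (LightTail.mulDist (d m) F) := by
  open LightTail in
  have hf := hrate.moderateTail hcond
  have hlow : (∃ A : ℝ, F (Set.Iic A) = 0) ∨ TailBalanced F := hstd.lower_tail.imp_right And.left
  have hneg : tail (mulDist (-1) F) =O[atTop] tail F := by
    rcases hlow with ⟨A, hA⟩ | hb
    · refine IsBigO.of_bound 1 ?_
      filter_upwards [tail_mulDist_of_neg_of_bddBelow hA neg_one_lt_zero] with t ht
      rw [ht, norm_zero]
      positivity
    · exact hb.isTheta.1
  have habs := isBigO_measureReal_lt_abs hneg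
  have hwin : ∀ c : ℝ, c ≠ 0 → ∃ a C : ℝ, 0 < a ∧ 0 < C ∧ ∀ᶠ t in atTop, ∀ s, 0 ≤ s → s ≤ t / 2 →
      tail (mulDist c F) (t - s) - tail (mulDist c F) (t + s) ≤
        C * (t ^ (-(3 / 4) : ℝ) * tail F (a * t)) * s := by
    intro c hc
    rcases lt_or_gt_of_ne hc with hc | hc
    · rcases hstd.lower_tail with ⟨A, hA⟩ | ⟨-, hm, hm1, hm2⟩
      · refine ⟨1, 1, one_pos, one_pos, ?_⟩
        obtain ⟨t₀, ht₀⟩ := eventually_atTop.1 (tail_mulDist_of_neg_of_bddBelow hA hc)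
        filter_upwards [eventually_ge_atTop (2 * t₀), eventually_gt_atTop 0] with t h1 ht s h2 h3
        rw [ht₀ (t - s) (by linarith), ht₀ (t + s) (by linarith), sub_self]
        have := hf.pos (1 * t)
        positivity
      · simp only [tail_mulDist_of_neg F hc]
        exact exists_window_bound hf (hm1.moderateTail hm2) hneg (inv_pos.2 (abs_pos.2 hc.ne))
    · simp only [tail_mulDist_of_pos F hc]
      exact exists_window_bound hf hf (isBigO_refl _ _) (inv_pos.2 hc)
  have hc : Summable fun i => |c i| := by
    obtain ⟨δ, hδ0, hδ1, hs⟩ := hstd.summable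
    refine hs.of_norm_bounded_eventually ?_
    filter_upwards [hs.tendsto_cofinite_zero.eventually_le_const one_pos] with i hi
    rw [Real.norm_eq_abs, abs_abs]
    have h1 : |c i| ≤ 1 := by
      by_contra! hgt
      exact absurd hi (not_le.2 (Real.one_lt_rpow hgt hδ0))
    simpa using Real.rpow_le_rpow_of_exponent_ge' (abs_nonneg _) h1 hδ0.le hδ1.le
  have hfinT := lintegral_tsum_enorm_lt_top hf habs hlaw hc
  refine ⟨?_, fun d hd m hm hdm => ?_⟩
  · have hT : ∀ᵐ ω ∂P, ∑' i, ‖c i * X i ω‖ₑ < ∞ :=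
      ae_lt_top' (AEMeasurable.tsum fun i =>
        ((hlaw i).aemeasurable.const_mul _).enorm) hfinT.ne
    filter_upwards [hT] with ω hω
    exact (tsum_enorm_ne_top_iff_summable_norm.1 hω.ne).of_norm
  · have hrel : TailRelevant F (d m) := by
      refine (eventually_zero_or_relevant hlow (d m)).resolve_left fun hz => ?_
      refine hd.not_equiv_zero m hm hdm ⟨1, one_pos, ?_⟩
      filter_upwards [hz, tail_mulDist_zero F] with t h1 h2
      simp [h1, h2]
    have hκ : 0 < |d m| := abs_pos.2 hdm
    have hIfin : {i | |d m| ≤ |c i|}.Finite := by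
      have := hc.tendsto_cofinite_zero.eventually_lt_const hκ
      simpa only [not_lt] using Filter.eventually_cofinite.1 this
    have hset : {i | Preceq F (d m) (c i)} = {i | TailRelevant F (c i) ∧ |d m| ≤ |c i|} :=
      Set.ext fun i => preceq_iff hf hlow hrel
    have hfin : {i | Preceq F (d m) (c i)}.Finite := by
      rw [hset]
      exact hIfin.subset fun i hi => hi.2
    refine ⟨hfin, ?_⟩
    have main := isLittleO_tail_series hf habs hwin hlaw hindep hc hκ hIfin.toFinset fun i => by
      simp
    refine (main.trans_isBigO hrel.2.2).congr' ?_ EventuallyEq.rfl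
    have hz : ∀ᶠ t in atTop, ∀ i ∈ hIfin.toFinset, i ∉ hfin.toFinset →
        tail (mulDist (c i) F) t = 0 := by
      rw [Finset.eventually_all]
      intro i hi
      by_cases hi' : i ∈ hfin.toFinset
      · exact Eventually.of_forall fun _ h => absurd hi' h
      · rcases eventually_zero_or_relevant hlow (c i) with hz | hr
        · filter_upwards [hz] with t ht _ using ht
        · refine absurd (hfin.mem_toFinset.2 ?_) hi'
          rw [hset]
          exact ⟨hr, hIfin.mem_toFinset.1 hi⟩
    refine hz.mono fun t ht => ?_
    beta_reduce
    rw [finsum_mem_eq_finite_toFinset_sum _ hfin]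
    congr 1
    refine (Finset.sum_subset (fun i hi => ?_) ht).symm
    have := hfin.mem_toFinset.1 hi
    rw [hset] at this
    exact hIfin.mem_toFinset.2 this.2
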